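/- Let $d\ge 1$ and let $\varphi:[0,\infty)\to[0,\infty)$ satisfy $\varphi(0)=0$, be continuous on $[0,\infty)$ except at finitely many points of $(0,\infty)$, where it has finite limits $\varphi(t-)$ and $\varphi(t+)$ from the left and from the right, and satisfy $\varphi(t)=\min\{\varphi(t-),\varphi(t+)\}$ for all $t>0$. Assume that $\varphi$ belongs to the class $\mathcal A$, that is: there are constants $a,b>0$ with $\varphi(t)\le a t^2$ for $t\in[0,1]$ and $\varphi(t)\le b$ for all $t\ge 0$; $\varphi$ is non-decreasing; and $$\gamma_d\int_0^\infty \varphi(t)\,t^{-2}\,dt=1,\qquad \gamma_d:=\int_{\mathbb S^{d-1}}|\sigma\cdot e|\,d\sigma ,$$ where $e\in\mathbb S^{d-1}$ is any unit vector ($\gamma_d$ does not depend on it). Assume moreover that $\varphi(t)>0$ for all $t>0$. Let $\Omega\subset\mathbb R^d$ be either a bounded open set with smooth ($C^\infty$) boundary (that is, near each boundary point $\Omega$ is, after a rigid motion, the region strictly above the graph of a $C^\infty$ function), or $\Omega=\mathbb R^d$, and for measurable $u:\Omega\to\mathbb R$ put $$\Lambda(u)=\int_\Omega\int_\Omega\frac{\varphi(|u(x)-u(y)|)}{|x-y|^{d+1}}\,dx\,dy\in[0,\infty].$$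 Let $(u_n)$ be a bounded sequence in $L^1(\Omega)$ such that $\sup_n\Lambda(u_n)<+\infty$. Then there exist a subsequence $(u_{n_k})$ of $(u_n)$ and a function $u\in L^1(\Omega)$ such that $(u_{n_k})$ converges to $u$ in $L^1(\Omega)$ if $\Omega$ is bounded, respectively in $L^1_{\mathrm{loc}}(\mathbb R^d)$ if $\Omega=\mathbb R^d$. -/

import Mathlib

open MeasureTheory Set Filter Topology
open scoped ENNReal ContDiff

namespace NonlocalTV

/-- The standing regularity assumptions on `φ : [0,∞) → [0,∞)`. A function on `[0,∞)` is represented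
by a function on `ℝ` of which only the values at `t ≥ 0` are read: it is nonnegative, `φ 0 = 0`, it
is continuous on `[0,∞)` off a finite set of points of `(0,∞)`, and at these points it has finite
one-sided limits and takes the smaller of the two as its value. (At the points of `(0,∞)` where `φ`
is continuous, `φ t = min (φ (t-)) (φ (t+))` is automatic.) -/
structure IsAdmissible (φ : ℝ → ℝ) : Prop where
  nonneg : ∀ t, 0 ≤ t → 0 ≤ φ t
  zero : φ 0 = 0
  piecewise : ∃ S : Set ℝ, S.Finite ∧ S ⊆ Ioi 0 ∧
    (∀ t, 0 ≤ t → t ∉ S → ContinuousWithinAt φ (Ici 0) t) ∧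
    ∀ t ∈ S, ∃ l r : ℝ, Tendsto φ (𝓝[<] t) (𝓝 l) ∧ Tendsto φ (𝓝[>] t) (𝓝 r) ∧ φ t = min l r

/-- `∫_{𝕊^{d-1}} |σ ⬝ e| dσ` with respect to the surface measure of the unit sphere of `ℝ^d`
(for `d = 1`, the counting measure on the two points of the sphere). -/
noncomputable def sphereMoment (d : ℕ) (e : EuclideanSpace ℝ (Fin d)) : ℝ :=
  ∫ σ : Metric.sphere (0 : EuclideanSpace ℝ (Fin d)) 1,
    |inner ℝ (σ : EuclideanSpace ℝ (Fin d)) e|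
      ∂((volume : Measure (EuclideanSpace ℝ (Fin d))).toSphere)

/-- The class `𝒜` in dimension `d`. In the normalization, `sphereMoment d e` does not depend on the
unit vector `e`; as the product of the two integrals equals `1`, both integrals converge. -/
structure ClassA (d : ℕ) (φ : ℝ → ℝ) : Prop where
  admissible : IsAdmissible φ
  quadratic : ∃ a : ℝ, 0 < a ∧ ∀ t ∈ Icc (0 : ℝ) 1, φ t ≤ a * t ^ 2
  bounded : ∃ b : ℝ, 0 < b ∧ ∀ t, 0 ≤ t → φ t ≤ b
  monotone : MonotoneOn φ (Ici 0)
  normalized : ∃ e : EuclideanSpace ℝ (Fin d), ‖e‖ = 1 ∧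
    sphereMoment d e * ∫ t in Ioi (0 : ℝ), φ t / t ^ 2 = 1

/-- `Λ(u, Ω) = ∫_Ω ∫_Ω φ(|u(x) - u(y)|) / |x - y|^{d+1} dx dy`, with values in `[0,∞]`. -/
noncomputable def Lam {d : ℕ} (φ : ℝ → ℝ) (Ω : Set (EuclideanSpace ℝ (Fin d)))
    (u : EuclideanSpace ℝ (Fin d) → ℝ) : ℝ≥0∞ :=
  ∫⁻ x in Ω, ∫⁻ y in Ω, ENNReal.ofReal (φ |u x - u y| / ‖x - y‖ ^ (d + 1))

/-- A bounded open set with `C^∞` boundary: near each of its boundary points, after a rigid motion,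
`Ω` is the region lying strictly above the graph of a smooth function. Here `e` is the upward unit
vector, `inner ℝ e x` the height of `x`, and `x - inner ℝ e x • e` the projection of `x` to the
hyperplane `e^⊥`; only the values of `γ` on this hyperplane are read. -/
structure IsSmoothBounded {d : ℕ} (Ω : Set (EuclideanSpace ℝ (Fin d))) : Prop where
  isOpen : IsOpen Ω
  isBounded : Bornology.IsBounded Ω
  boundary : ∀ x₀ ∈ frontier Ω, ∃ (r : ℝ) (e : EuclideanSpace ℝ (Fin d))
    (γ : EuclideanSpace ℝ (Fin d) → ℝ), 0 < r ∧ ‖e‖ = 1 ∧ ContDiff ℝ ∞ γ ∧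
      ∀ x ∈ Metric.ball x₀ r, x ∈ Ω ↔ γ (x - inner ℝ e x • e) < inner ℝ e x

end NonlocalTV

namespace NonlocalTV

set_option linter.unusedSectionVars false

/-! ### Integrals over pairs of nearby points, and midpoints -/

section Poincare

variable {V : Type*} [NormedAddCommGroup V] [NormedSpace ℝ V] [FiniteDimensional ℝ V]
  [MeasurableSpace V] [BorelSpace V] (μ : Measure V) [μ.IsAddHaarMeasure]

/-! Since `φ` is non-decreasing and positive off `0`, a bound on `Λ(u_n)` bounds, for each fixed `τ
> 0`, the integral of `|x - y|^{-(d+1)}` over the pairs with `|u_n(x) - u_n(y)| > τ`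
(`lintegral_jumpKernel_le`). Nothing else about `φ` is needed.

This yields a Poincaré inequality on convex sets `q` of diameter at most `r`, up to an error `τ
|q|²` (`lintegral_enorm_sub_le`). An increment larger than `τ` is split at the midpoint: up to an
error `2τ`, it is at most the sum of those increments over the two halves that again exceed the same
`τ`. The passage to midpoints costs a Jacobian `2^d`, and there are two halves, so each halving of
the scale costs `2^{d+1}`. After iteration, the errors at a pair `x, y` add up to `2τ` times the sum
of `2^{(d+1)k}` over the `k` with `|x - y| ≤ r/2^k`, which is of order `τ (r/|x - y|)^{d+1}`:
exactly the controlled kernel.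

On a cube divided into `N^d` subcubes, the distance in `L¹` from `u_n` to its averages is then at
most a multiple of `τ`, plus a term of order `1/N` for fixed `τ`, uniformly in `n`. The averages
range over a bounded set of a finite-dimensional space, so the sequence is totally bounded in `L¹`
of the cube (`isL1Precompact_cube`).

Near a boundary point, a shear straightens the graph; it preserves volume and is locally Lipschitz,
so the cube estimate carries over, and compactness of the closure of `Ω` glues the local statements.
On `ℝ^d`, a decaying weight turns local compactness into compactness in a single `L¹` space. -/

theorem lintegral_comp_midpoint (x : V) {G : V → ℝ≥0∞} (hG : Measurable G) :
    ∫⁻ y, G (midpoint ℝ x y) ∂μ = 2 ^ Module.finrank ℝ V * ∫⁻ z, G z ∂μ := by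
  have h1 : ∀ y, midpoint ℝ x y = (2⁻¹ : ℝ) • (x + y) := fun y => by
    rw [midpoint_eq_smul_add]; simp
  simp_rw [h1]
  rw [lintegral_add_left_eq_self (μ := μ) (fun y => G ((2⁻¹ : ℝ) • y)) x,
    ← lintegral_map (μ := μ) hG (measurable_const_smul (2⁻¹ : ℝ)),
    Measure.map_addHaar_smul μ (by norm_num : (2⁻¹ : ℝ) ≠ 0), lintegral_smul_measure]
  congr 1
  simp [abs_of_pos, ENNReal.ofReal_pow]

theorem measurable_midpoint : Measurable fun p : V × V => midpoint ℝ p.1 p.2 := by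
  have : Continuous fun p : V × V => midpoint ℝ p.1 p.2 := by
    simp_rw [midpoint_eq_smul_add]; fun_prop
  exact this.measurable

/-- The integral of `f` over the pairs of points of `q` at distance at most `ρ`. -/
noncomputable def nearIntegral (q : Set V) (ρ : ℝ) (f : V → V → ℝ≥0∞) : ℝ≥0∞ :=
  ∫⁻ x in q, ∫⁻ y in q, (if ‖x - y‖ ≤ ρ then f x y else 0) ∂μ ∂μ

variable {q : Set V} {f g : V → V → ℝ≥0∞} {ρ : ℝ}

theorem measurable_ite_norm_sub_le (hf : Measurable (Function.uncurry f)) :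
    Measurable (Function.uncurry fun x y => if ‖x - y‖ ≤ ρ then f x y else 0) :=
  Measurable.ite (measurableSet_le (by fun_prop) measurable_const) hf measurable_const

theorem measurable_lintegral_ite_norm_sub_le (hf : Measurable (Function.uncurry f)) :
    Measurable fun x => ∫⁻ y in q, (if ‖x - y‖ ≤ ρ then f x y else 0) ∂μ :=
  (measurable_ite_norm_sub_le hf).lintegral_prod_right'

theorem measurable_ite_norm_sub_le_right (hf : Measurable (Function.uncurry f)) (x : V) :
    Measurable fun y => if ‖x - y‖ ≤ ρ then f x y else 0 :=
  (measurable_ite_norm_sub_le hf).comp measurable_prodMk_left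

variable {μ} in
theorem nearIntegral_mono (h : ∀ x y, f x y ≤ g x y) :
    nearIntegral μ q ρ f ≤ nearIntegral μ q ρ g :=
  lintegral_mono fun x => lintegral_mono fun y => by
    dsimp only; split_ifs; exacts [h x y, le_rfl]

variable {μ} in
theorem nearIntegral_add (hf : Measurable (Function.uncurry f)) :
    nearIntegral μ q ρ (fun x y => f x y + g x y)
      = nearIntegral μ q ρ f + nearIntegral μ q ρ g := by
  unfold nearIntegral
  rw [← lintegral_add_left (measurable_lintegral_ite_norm_sub_le μ hf)]
  refine lintegral_congr fun x => ?_
  rw [← lintegral_add_left (measurable_ite_norm_sub_le_right hf x)]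
  refine lintegral_congr fun y => ?_
  split_ifs <;> simp

variable {μ} in
theorem nearIntegral_const_mul {c : ℝ≥0∞} (hf : Measurable (Function.uncurry f)) :
    nearIntegral μ q ρ (fun x y => c * f x y) = c * nearIntegral μ q ρ f := by
  unfold nearIntegral
  rw [← lintegral_const_mul _ (measurable_lintegral_ite_norm_sub_le μ hf)]
  refine lintegral_congr fun x => ?_
  rw [← lintegral_const_mul _ (measurable_ite_norm_sub_le_right hf x)]
  refine lintegral_congr fun y => ?_
  split_ifs <;> simp

variable {μ} in
theorem nearIntegral_swap (hf : Measurable (Function.uncurry f)) :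
    nearIntegral μ q ρ (fun x y => f y x) = nearIntegral μ q ρ f := by
  have hs : Measurable (Function.uncurry fun x y => f y x) := hf.comp measurable_swap
  unfold nearIntegral
  rw [lintegral_lintegral_swap]
  · simp_rw [norm_sub_rev]
  · exact (measurable_ite_norm_sub_le hs).aemeasurable

variable {μ} in
-- For fixed `x`, the map from `y` to the midpoint stays in `q` by convexity, halves the distance to
-- `x`, and has Jacobian `2^{-d}`, where `d` is the dimension of `V`.
theorem nearIntegral_midpoint_right_le (hq : Convex ℝ q) (hqm : MeasurableSet q)
    (hf : Measurable (Function.uncurry f)) :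
    nearIntegral μ q ρ (fun x y => f x (midpoint ℝ x y))
      ≤ 2 ^ Module.finrank ℝ V * nearIntegral μ q (ρ / 2) f := by
  unfold nearIntegral
  rw [← lintegral_const_mul _ (measurable_lintegral_ite_norm_sub_le μ hf)]
  refine setLIntegral_mono' hqm fun x hx => ?_
  set G : V → ℝ≥0∞ := q.indicator fun z => if ‖x - z‖ ≤ ρ / 2 then f x z else 0 with hGdef
  have hG : Measurable G := (measurable_ite_norm_sub_le_right hf x).indicator hqm
  have h2 : (∫⁻ z in q, if ‖x - z‖ ≤ ρ / 2 then f x z else 0 ∂μ) = ∫⁻ z, G z ∂μ :=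
    (lintegral_indicator hqm _).symm
  change _ ≤ _ * ∫⁻ z in q, (if ‖x - z‖ ≤ ρ / 2 then f x z else 0) ∂μ
  rw [h2, ← lintegral_comp_midpoint μ x hG, ← lintegral_indicator hqm]
  refine lintegral_mono fun y => ?_
  by_cases hy : y ∈ q
  · have hm : midpoint ℝ x y ∈ q := hq.midpoint_mem hx hy
    have hd : ‖x - midpoint ℝ x y‖ = ‖x - y‖ / 2 := by
      rw [← dist_eq_norm, dist_left_midpoint, dist_eq_norm]; simp; ring
    simp only [hy, hm, hGdef, indicator_of_mem, hd]
    split_ifs with h h'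
    · exact le_rfl
    · exact absurd (by linarith) h'
    · exact zero_le
    · exact le_rfl
  · simp [hy]

variable {μ} in
theorem nearIntegral_midpoint_left_le (hq : Convex ℝ q) (hqm : MeasurableSet q)
    (hf : Measurable (Function.uncurry f)) :
    nearIntegral μ q ρ (fun x y => f (midpoint ℝ x y) y)
      ≤ 2 ^ Module.finrank ℝ V * nearIntegral μ q (ρ / 2) f := by
  have hm := measurable_midpoint (V := V)
  have hf' : Measurable (Function.uncurry fun x y => f (midpoint ℝ x y) y) :=
    hf.comp (hm.prodMk measurable_snd)
  rw [← nearIntegral_swap hf', ← nearIntegral_swap hf]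
  refine le_trans (le_of_eq ?_) (nearIntegral_midpoint_right_le hq hqm (hf.comp measurable_swap))
  simp_rw [midpoint_comm (R := ℝ)]

end Poincare

/-! ### Increments above a threshold -/

section Jumps

variable {V : Type*}

/-- The increment of `w` between `x` and `y` if it exceeds `τ`, and `0` otherwise. -/
noncomputable def bigJump (w : V → ℝ) (τ : ℝ) (x y : V) : ℝ≥0∞ :=
  if τ < |w x - w y| then ‖w x - w y‖ₑ else 0

/-- The indicator of the pairs between which `w` has an increment larger than `τ`. -/
noncomputable def jumpIndicator (w : V → ℝ) (τ : ℝ) (x y : V) : ℝ≥0∞ :=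
  if τ < |w x - w y| then 1 else 0

/-- The kernel `‖x - y‖ ^ (-n)` on the pairs between which `w` has an increment larger
than `τ`. -/
noncomputable def jumpKernel [NormedAddCommGroup V] (n : ℕ) (w : V → ℝ) (τ : ℝ) (x y : V) : ℝ≥0∞ :=
  if τ < |w x - w y| then (‖x - y‖ₑ ^ n)⁻¹ else 0

theorem enorm_sub_le_add_bigJump (w : V → ℝ) (τ : ℝ) (x y : V) :
    ‖w x - w y‖ₑ ≤ ENNReal.ofReal τ + bigJump w τ x y := by
  unfold bigJump
  split_ifs with h
  · exact le_add_self
  · rw [add_zero, Real.enorm_eq_ofReal_abs]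
    exact ENNReal.ofReal_le_ofReal (not_lt.1 h)

/-- Triangle inequality through `m`: on each half, an increment not exceeding `τ` costs at most `τ`.
The error `2τ` is charged only to pairs that themselves jump, which keeps it under control of the
kernel. -/
theorem bigJump_le (w : V → ℝ) (τ : ℝ) (x m y : V) :
    bigJump w τ x y ≤ 2 * ENNReal.ofReal τ * jumpIndicator w τ x y
      + (bigJump w τ x m + bigJump w τ m y) := by
  by_cases h : τ < |w x - w y|
  · have h1 := enorm_sub_le_add_bigJump w τ x m
    have h2 := enorm_sub_le_add_bigJump w τ m y
    have h3 : ‖w x - w y‖ₑ ≤ ‖w x - w m‖ₑ + ‖w m - w y‖ₑ := by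
      simpa using enorm_add_le (w x - w m) (w m - w y)
    rw [bigJump, jumpIndicator, if_pos h, if_pos h, mul_one]
    refine h3.trans ((add_le_add h1 h2).trans (le_of_eq ?_))
    ring
  · rw [bigJump, if_neg h]; exact zero_le

theorem bigJump_le_mul_jumpIndicator {w : V → ℝ} {M : ℝ} (hM : ∀ x, |w x| ≤ M) (τ : ℝ) (x y : V) :
    bigJump w τ x y ≤ ENNReal.ofReal (2 * M) * jumpIndicator w τ x y := by
  unfold bigJump jumpIndicator
  split_ifs with h
  · rw [mul_one, Real.enorm_eq_ofReal_abs]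
    exact ENNReal.ofReal_le_ofReal (by linarith [abs_sub (w x) (w y), hM x, hM y])
  · exact zero_le

variable [MeasurableSpace V]

theorem measurableSet_jump {w : V → ℝ} (hw : Measurable w) (τ : ℝ) :
    MeasurableSet {p : V × V | τ < |w p.1 - w p.2|} :=
  measurableSet_lt measurable_const (by fun_prop)

theorem measurable_bigJump {w : V → ℝ} (hw : Measurable w) (τ : ℝ) :
    Measurable (Function.uncurry (bigJump w τ)) :=
  Measurable.ite (measurableSet_jump hw τ) (by fun_prop) measurable_const

theorem measurable_jumpIndicator {w : V → ℝ} (hw : Measurable w) (τ : ℝ) :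
    Measurable (Function.uncurry (jumpIndicator w τ)) :=
  Measurable.ite (measurableSet_jump hw τ) (by fun_prop) measurable_const

theorem measurable_jumpKernel [NormedAddCommGroup V] [SecondCountableTopology V] [BorelSpace V]
    {w : V → ℝ} (hw : Measurable w) (n : ℕ) (τ : ℝ) :
    Measurable (Function.uncurry (jumpKernel n w τ)) :=
  Measurable.ite (measurableSet_jump hw τ) (by fun_prop) measurable_const

end Jumps

/-- The admissible `k` form an initial segment. A geometric sum of ratio `2^n ≥ 2` is at most twice
its last term, and the last admissible `k` satisfies `2^k ≤ r/t`. -/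
theorem sum_two_pow_le {n : ℕ} (hn : 1 ≤ n) {t r : ℝ} (ht : 0 < t) (hr : 0 < r) (K : ℕ) :
    (∑ k ∈ Finset.range K, if t ≤ r / 2 ^ k then ((2 : ℝ) ^ n) ^ k else 0) ≤ 2 * (r / t) ^ n := by
  induction K with
  | zero => simp; positivity
  | succ K ih =>
    by_cases h : t ≤ r / 2 ^ K
    · have hA : (2 : ℝ) ≤ 2 ^ n := by simpa using pow_le_pow_right₀ (one_le_two : (1 : ℝ) ≤ 2) hn
      have h1 : ∀ m : ℕ, ∑ k ∈ Finset.range (m + 1), ((2 : ℝ) ^ n) ^ k ≤ 2 * ((2 : ℝ) ^ n) ^ m := by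
        intro m
        induction m with
        | zero => simp
        | succ m ihm =>
          rw [Finset.sum_range_succ]
          have : 2 * ((2 : ℝ) ^ n) ^ m ≤ ((2 : ℝ) ^ n) ^ (m + 1) := by
            rw [pow_succ' _ m]; gcongr
          linarith
      calc _ ≤ ∑ k ∈ Finset.range (K + 1), ((2 : ℝ) ^ n) ^ k :=
            Finset.sum_le_sum fun k _ => by split_ifs <;> [exact le_rfl; positivity]
        _ ≤ 2 * ((2 : ℝ) ^ n) ^ K := h1 K
        _ ≤ 2 * (r / t) ^ n := by
            rw [← pow_mul, mul_comm n K, pow_mul]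
            gcongr
            rw [le_div_iff₀ (by positivity)] at h
            rw [le_div_iff₀ ht]; linarith
    · rw [Finset.sum_range_succ, if_neg h, add_zero]; exact ih

theorem sum_two_pow_le_ofReal {n : ℕ} (hn : 1 ≤ n) {t r : ℝ} (ht : 0 < t) (hr : 0 < r) (K : ℕ) :
    (∑ k ∈ Finset.range K, ((2 : ℝ≥0∞) ^ n) ^ k * if t ≤ r / 2 ^ k then 1 else 0)
      ≤ 2 * ENNReal.ofReal r ^ n * (ENNReal.ofReal t ^ n)⁻¹ := by
  have h := ENNReal.ofReal_le_ofReal (sum_two_pow_le hn ht hr K)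
  rw [ENNReal.ofReal_sum_of_nonneg (fun k _ => by split_ifs <;> positivity), div_pow,
    ENNReal.ofReal_mul zero_le_two, ENNReal.ofReal_div_of_pos (by positivity),
    ENNReal.ofReal_pow hr.le, ENNReal.ofReal_pow ht.le, ENNReal.ofReal_ofNat] at h
  rw [mul_assoc, ← div_eq_mul_inv]
  refine le_trans (le_of_eq (Finset.sum_congr rfl fun k _ => ?_)) h
  split_ifs
  · rw [ENNReal.ofReal_pow (by positivity), ENNReal.ofReal_pow (by positivity)]; simp
  · simp

/-! ### The Poincaré inequality by repeated bisection -/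

section Poincare

variable {V : Type*} [NormedAddCommGroup V] [NormedSpace ℝ V] [FiniteDimensional ℝ V]
  [MeasurableSpace V] [BorelSpace V] {μ : Measure V} [μ.IsAddHaarMeasure] {q : Set V} {w : V → ℝ}

/-- One bisection. The threshold stays the same while the scale is halved, so the step can be
iterated. -/
theorem nearIntegral_bigJump_le (hq : Convex ℝ q) (hqm : MeasurableSet q) (hw : Measurable w)
    (τ ρ : ℝ) :
    nearIntegral μ q ρ (bigJump w τ)
      ≤ 2 * ENNReal.ofReal τ * nearIntegral μ q ρ (jumpIndicator w τ)
        + 2 ^ (Module.finrank ℝ V + 1) * nearIntegral μ q (ρ / 2) (bigJump w τ) := by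
  have hm := measurable_midpoint (V := V)
  have hb := measurable_bigJump hw τ
  have hi := measurable_jumpIndicator hw τ
  have hi' : Measurable (Function.uncurry fun x y =>
      2 * ENNReal.ofReal τ * jumpIndicator w τ x y) := hi.const_mul _
  have h1 : Measurable (Function.uncurry fun x y => bigJump w τ x (midpoint ℝ x y)) :=
    hb.comp (measurable_fst.prodMk hm)
  refine (nearIntegral_mono fun x y => bigJump_le w τ x (midpoint ℝ x y) y).trans ?_
  rw [nearIntegral_add hi', nearIntegral_const_mul hi, nearIntegral_add h1, pow_succ, mul_two,
    add_mul]
  gcongr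
  · exact nearIntegral_midpoint_right_le hq hqm hb
  · exact nearIntegral_midpoint_left_le hq hqm hb

theorem nearIntegral_bigJump_le_sum (hq : Convex ℝ q) (hqm : MeasurableSet q) (hw : Measurable w)
    (τ r : ℝ) (K : ℕ) :
    nearIntegral μ q r (bigJump w τ)
      ≤ 2 * ENNReal.ofReal τ * ∑ k ∈ Finset.range K, (2 ^ (Module.finrank ℝ V + 1)) ^ k
          * nearIntegral μ q (r / 2 ^ k) (jumpIndicator w τ)
        + (2 ^ (Module.finrank ℝ V + 1)) ^ K * nearIntegral μ q (r / 2 ^ K) (bigJump w τ) := by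
  induction K with
  | zero => simp
  | succ K ih =>
    refine ih.trans ?_
    rw [Finset.sum_range_succ, mul_add, add_assoc]
    gcongr
    refine (mul_le_mul_right (nearIntegral_bigJump_le hq hqm hw τ (r / 2 ^ K)) _).trans
      (le_of_eq ?_)
    rw [pow_succ (2 : ℝ) K, ← div_div, pow_succ _ K]
    ring

/-- Sum and integrals commute, and pointwise this is the dyadic sum with `t = ‖x - y‖`, which is
positive because a point has no jump with itself. -/
theorem sum_nearIntegral_jumpIndicator_le (hw : Measurable w) {τ r : ℝ} (hτ : 0 ≤ τ) (hr : 0 < r)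
    (K : ℕ) :
    ∑ k ∈ Finset.range K, (2 ^ (Module.finrank ℝ V + 1)) ^ k
          * nearIntegral μ q (r / 2 ^ k) (jumpIndicator w τ)
      ≤ 2 * ENNReal.ofReal r ^ (Module.finrank ℝ V + 1)
          * ∫⁻ x in q, ∫⁻ y in q, jumpKernel (Module.finrank ℝ V + 1) w τ x y ∂μ ∂μ := by
  set n := Module.finrank ℝ V + 1
  have hi := measurable_jumpIndicator hw τ
  have hJ := measurable_jumpKernel (V := V) hw n τ
  have hJ1 : Measurable fun x => ∫⁻ y in q, jumpKernel n w τ x y ∂μ := hJ.lintegral_prod_right'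
  have hJ2 : ∀ x, Measurable fun y => jumpKernel n w τ x y :=
    fun x => hJ.comp measurable_prodMk_left
  unfold nearIntegral
  rw [← lintegral_const_mul _ hJ1]
  rw [Finset.sum_congr rfl fun k _ => (lintegral_const_mul ((2 ^ n) ^ k : ℝ≥0∞)
    (measurable_lintegral_ite_norm_sub_le μ (q := q) (ρ := r / 2 ^ k) hi)).symm]
  rw [← lintegral_finsetSum _ fun k _ =>
    (measurable_lintegral_ite_norm_sub_le μ (q := q) (ρ := r / 2 ^ k) hi).const_mul _]
  refine lintegral_mono fun x => ?_
  dsimp only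
  rw [← lintegral_const_mul _ (hJ2 x)]
  rw [Finset.sum_congr rfl fun k _ => (lintegral_const_mul ((2 ^ n) ^ k : ℝ≥0∞)
    (measurable_ite_norm_sub_le_right (ρ := r / 2 ^ k) hi x)).symm]
  rw [← lintegral_finsetSum _ fun k _ =>
    (measurable_ite_norm_sub_le_right (ρ := r / 2 ^ k) hi x).const_mul _]
  refine lintegral_mono fun y => ?_
  dsimp only
  unfold jumpIndicator jumpKernel
  by_cases h : τ < |w x - w y|
  · have hxy : 0 < ‖x - y‖ := by
      rw [norm_pos_iff, sub_ne_zero]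
      rintro rfl
      simp at h
      linarith
    simp only [h, if_true]
    rw [← ofReal_norm]
    exact sum_two_pow_le_ofReal (by omega) hxy hr K
  · simp [h]

/-- For bounded `w`, the remainder after `K` bisections is at most `2M` times the `K`-th term of the
series of errors. That series converges when the kernel integral is finite, so the remainder
vanishes in the limit. -/
theorem nearIntegral_bigJump_le_of_bounded (hq : Convex ℝ q) (hqm : MeasurableSet q)
    (hw : Measurable w) {M : ℝ} (hM : ∀ x, |w x| ≤ M) {τ r : ℝ} (hτ : 0 < τ) (hr : 0 < r) :
    nearIntegral μ q r (bigJump w τ)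
      ≤ 4 * ENNReal.ofReal τ * ENNReal.ofReal r ^ (Module.finrank ℝ V + 1)
          * ∫⁻ x in q, ∫⁻ y in q, jumpKernel (Module.finrank ℝ V + 1) w τ x y ∂μ ∂μ := by
  set n := Module.finrank ℝ V + 1
  set I := ∫⁻ x in q, ∫⁻ y in q, jumpKernel n w τ x y ∂μ ∂μ
  have hτ0 : ENNReal.ofReal τ ≠ 0 := by simpa using hτ
  have hr0 : ENNReal.ofReal r ≠ 0 := by simpa using hr
  by_cases hI : I = ⊤
  · rw [hI, ENNReal.mul_top]
    · exact le_top
    · exact mul_ne_zero (mul_ne_zero (by norm_num) hτ0) (pow_ne_zero _ hr0)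
  set a : ℕ → ℝ≥0∞ := fun k => (2 ^ n) ^ k * nearIntegral μ q (r / 2 ^ k) (jumpIndicator w τ)
  have hsum := sum_nearIntegral_jumpIndicator_le (μ := μ) (q := q) hw hτ.le hr
  have ha : Tendsto a atTop (𝓝 0) := by
    refine ENNReal.tendsto_atTop_zero_of_tsum_ne_top (ne_top_of_le_ne_top ?_
      (ENNReal.tsum_le_of_sum_range_le hsum))
    exact ENNReal.mul_ne_top (by finiteness) hI
  have hle : ∀ K, nearIntegral μ q r (bigJump w τ)
      ≤ 4 * ENNReal.ofReal τ * ENNReal.ofReal r ^ n * I + ENNReal.ofReal (2 * M) * a K := by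
    intro K
    refine (nearIntegral_bigJump_le_sum hq hqm hw τ r K).trans (add_le_add ?_ ?_)
    · refine (mul_le_mul_right (hsum K) _).trans (le_of_eq ?_)
      ring
    · have := nearIntegral_mono (μ := μ) (q := q) (ρ := r / 2 ^ K)
        (bigJump_le_mul_jumpIndicator hM τ)
      rw [nearIntegral_const_mul (measurable_jumpIndicator hw τ)] at this
      refine (mul_le_mul_right this _).trans (le_of_eq ?_)
      simp only [a]; ring
  have hlim : Tendsto (fun K => 4 * ENNReal.ofReal τ * ENNReal.ofReal r ^ n * I
      + ENNReal.ofReal (2 * M) * a K) atTop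
      (𝓝 (4 * ENNReal.ofReal τ * ENNReal.ofReal r ^ n * I + ENNReal.ofReal (2 * M) * 0)) :=
    tendsto_const_nhds.add (ENNReal.Tendsto.const_mul ha (Or.inr ENNReal.ofReal_ne_top))
  rw [mul_zero, add_zero] at hlim
  exact ge_of_tendsto' hlim hle

/-- A Poincaré inequality controlled by the increments larger than `τ` only. -/
theorem lintegral_enorm_sub_le (hq : Convex ℝ q) (hqm : MeasurableSet q) (hw : Measurable w)
    {τ r : ℝ} (hτ : 0 < τ) (hr : 0 < r) (hqr : ∀ x ∈ q, ∀ y ∈ q, ‖x - y‖ ≤ r) :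
    ∫⁻ x in q, ∫⁻ y in q, ‖w x - w y‖ₑ ∂μ ∂μ
      ≤ ENNReal.ofReal τ * μ q * μ q
        + 4 * ENNReal.ofReal τ * ENNReal.ofReal r ^ (Module.finrank ℝ V + 1)
          * ∫⁻ x in q, ∫⁻ y in q, jumpKernel (Module.finrank ℝ V + 1) w τ x y ∂μ ∂μ := by
  set n := Module.finrank ℝ V + 1
  set C := ENNReal.ofReal τ * μ q * μ q
        + 4 * ENNReal.ofReal τ * ENNReal.ofReal r ^ n
          * ∫⁻ x in q, ∫⁻ y in q, jumpKernel n w τ x y ∂μ ∂μ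
  -- Truncation at height `M` does not increase increments, so the jumps of `c M` are among those of
  -- `w` and the bound is uniform in `M`.
  let c : ℕ → V → ℝ := fun M x => max (-M) (min M (w x))
  have hcm : ∀ M, Measurable (c M) := fun M =>
    measurable_const.max (measurable_const.min hw)
  have hc1 : ∀ M x, |c M x| ≤ M := fun M x => by
    rw [abs_le]
    exact ⟨le_max_left _ _, max_le (by linarith [M.cast_nonneg (α := ℝ)]) (min_le_left _ _)⟩
  have hc2 : ∀ M x y, |c M x - c M y| ≤ |w x - w y| := fun M x y => by
    have h1 := abs_max_sub_max_le_max (-M : ℝ) (min M (w x)) (-M) (min M (w y))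
    have h2 := abs_min_sub_min_le_max (M : ℝ) (w x) M (w y)
    simp only [sub_self, abs_zero, abs_nonneg, sup_of_le_right] at h1 h2
    exact h1.trans h2
  have hc3 : ∀ x, ∀ᶠ M in atTop, c M x = w x := fun x => by
    obtain ⟨N, hN⟩ := exists_nat_ge |w x|
    filter_upwards [eventually_ge_atTop N] with M hM
    have : |w x| ≤ M := hN.trans (by exact_mod_cast hM)
    rw [abs_le] at this
    simp [c, this.1, this.2]
  have hbound : ∀ M, ∫⁻ x in q, ∫⁻ y in q, ‖c M x - c M y‖ₑ ∂μ ∂μ ≤ C := by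
    intro M
    have hb := measurable_bigJump (hcm M) τ
    calc _ ≤ ∫⁻ x in q, (ENNReal.ofReal τ * μ q +
            ∫⁻ y in q, if ‖x - y‖ ≤ r then bigJump (c M) τ x y else 0 ∂μ) ∂μ := by
          refine setLIntegral_mono' hqm fun x hx => ?_
          rw [← setLIntegral_const, ← lintegral_add_left measurable_const]
          refine setLIntegral_mono' hqm fun y hy => ?_
          rw [if_pos (hqr x hx y hy)]
          exact enorm_sub_le_add_bigJump _ _ _ _
      _ = ENNReal.ofReal τ * μ q * μ q + nearIntegral μ q r (bigJump (c M) τ) := by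
          rw [lintegral_add_left measurable_const, setLIntegral_const]; rfl
      _ ≤ C := by
          refine add_le_add le_rfl ((nearIntegral_bigJump_le_of_bounded hq hqm (hcm M) (hc1 M)
            hτ hr).trans ?_)
          gcongr with x y
          unfold jumpKernel
          split_ifs with h1 h2
          · exact le_rfl
          · exact absurd (h1.trans_le (hc2 M x y)) h2
          · exact zero_le
          · exact le_rfl
  have hm : ∀ M, Measurable (Function.uncurry fun x y => ‖c M x - c M y‖ₑ) := fun M => by
    have := hcm M
    unfold Function.uncurry
    fun_prop
  have hm1 : ∀ M, Measurable fun x => ∫⁻ y in q, ‖c M x - c M y‖ₑ ∂μ :=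
    fun M => (hm M).lintegral_prod_right'
  -- Fatou's lemma, applied in each variable, removes the truncation.
  calc ∫⁻ x in q, ∫⁻ y in q, ‖w x - w y‖ₑ ∂μ ∂μ
      = ∫⁻ x in q, ∫⁻ y in q, liminf (fun M => ‖c M x - c M y‖ₑ) atTop ∂μ ∂μ := by
        refine lintegral_congr fun x => lintegral_congr fun y => ?_
        refine (Tendsto.liminf_eq (tendsto_const_nhds.congr' ?_)).symm
        filter_upwards [hc3 x, hc3 y] with M h1 h2
        rw [h1, h2]
    _ ≤ ∫⁻ x in q, liminf (fun M => ∫⁻ y in q, ‖c M x - c M y‖ₑ ∂μ) atTop ∂μ :=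
        lintegral_mono fun x => lintegral_liminf_le fun M => (hm M).comp measurable_prodMk_left
    _ ≤ liminf (fun M => ∫⁻ x in q, ∫⁻ y in q, ‖c M x - c M y‖ₑ ∂μ ∂μ) atTop :=
        lintegral_liminf_le hm1
    _ ≤ C := liminf_le_of_le (by isBoundedDefault) fun b hb => by
        obtain ⟨M, hM⟩ := hb.exists
        exact hM.trans (hbound M)

end Poincare

/-- Total boundedness of the sequence `u` in the pseudometric of `L¹(μ)`. -/
def IsL1Precompact {X : Type*} [MeasurableSpace X] (μ : Measure X) (u : ℕ → X → ℝ) : Prop :=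
  ∀ ε : ℝ≥0∞, ε ≠ 0 → ∃ (α : Type) (_ : Finite α) (c : ℕ → α), ∀ m n, c m = c n →
    ∫⁻ x, ‖u m x - u n x‖ₑ ∂μ ≤ ε

/-- The colour of `n` records the integer parts of the `a n j / η`; boundedness leaves finitely
many. -/
theorem exists_finite_coloring {κ : Type} [Finite κ] {a : ℕ → κ → ℝ} {R η : ℝ} (hη : 0 < η)
    (ha : ∀ n j, |a n j| ≤ R) :
    ∃ (α : Type) (_ : Finite α) (c : ℕ → α), ∀ m n, c m = c n → ∀ j, |a m j - a n j| ≤ η := by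
  refine ⟨κ → Icc ⌊-R / η⌋ ⌊R / η⌋, inferInstance, fun n j => ⟨⌊a n j / η⌋, ?_, ?_⟩, ?_⟩
  · exact Int.floor_le_floor (by have := (abs_le.1 (ha n j)).1; gcongr)
  · exact Int.floor_le_floor (by have := (abs_le.1 (ha n j)).2; gcongr)
  · intro m n h j
    have h1 : ⌊a m j / η⌋ = ⌊a n j / η⌋ := congrArg Subtype.val (congrFun h j)
    have h2 := Int.abs_sub_lt_one_of_floor_eq_floor h1
    rw [← sub_div, abs_div, abs_of_pos hη, div_lt_one hη] at h2
    exact h2.le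

theorem enorm_sub_setAverage_le {X : Type*} [MeasurableSpace X] {μ : Measure X} {q : Set X}
    (h0 : μ q ≠ 0) (htop : μ q ≠ ⊤) {w : X → ℝ} (hw : IntegrableOn w q μ) (x : X) :
    ‖w x - ⨍ y in q, w y ∂μ‖ₑ ≤ (μ q)⁻¹ * ∫⁻ y in q, ‖w x - w y‖ₑ ∂μ := by
  have : IsFiniteMeasure (μ.restrict q) := isFiniteMeasure_restrict.2 htop
  have hr : μ.real q ≠ 0 := (measureReal_ne_zero_iff htop).2 h0
  have h1 : w x - ⨍ y in q, w y ∂μ = (μ.real q)⁻¹ * ∫ y in q, (w x - w y) ∂μ := by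
    rw [integral_sub (integrable_const _) hw, setIntegral_const, setAverage_eq]
    simp only [smul_eq_mul]
    field_simp
  rw [h1, enorm_mul]
  gcongr
  · rw [enorm_inv hr, Real.enorm_eq_ofReal measureReal_nonneg, ofReal_measureReal htop]
  · exact enorm_integral_le_lintegral_enorm _

theorem enorm_setAverage_le {X : Type*} [MeasurableSpace X] {μ : Measure X} {q : Set X}
    (h0 : μ q ≠ 0) (htop : μ q ≠ ⊤) (w : X → ℝ) :
    ‖⨍ y in q, w y ∂μ‖ₑ ≤ (μ q)⁻¹ * ∫⁻ y in q, ‖w y‖ₑ ∂μ := by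
  have hr : μ.real q ≠ 0 := (measureReal_ne_zero_iff htop).2 h0
  rw [setAverage_eq, smul_eq_mul, enorm_mul]
  gcongr
  · rw [enorm_inv hr, Real.enorm_eq_ofReal measureReal_nonneg, ofReal_measureReal htop]
  · exact enorm_integral_le_lintegral_enorm _

/-! ### Total boundedness on a cube -/

section Cube

variable {ι : Type} [Fintype ι] [DecidableEq ι]

/-- The half-open cube with lower corner `c` and side length `l`. -/
def cube (c : ι → ℝ) (l : ℝ) : Set (ι → ℝ) := univ.pi fun i => Ioc (c i) (c i + l)

theorem measurableSet_cube (c : ι → ℝ) (l : ℝ) : MeasurableSet (cube c l) :=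
  MeasurableSet.univ_pi fun _ => measurableSet_Ioc

theorem convex_cube (c : ι → ℝ) (l : ℝ) : Convex ℝ (cube c l) :=
  convex_pi fun _ _ => convex_Ioc _ _

theorem volume_cube (c : ι → ℝ) (l : ℝ) :
    volume (cube c l) = ENNReal.ofReal l ^ Fintype.card ι := by
  rw [cube, Real.volume_pi_Ioc]
  simp

theorem norm_sub_le_of_mem_cube {c : ι → ℝ} {l : ℝ} (hl : 0 ≤ l) {x y : ι → ℝ} (hx : x ∈ cube c l)
    (hy : y ∈ cube c l) : ‖x - y‖ ≤ l := by
  refine (pi_norm_le_iff_of_nonneg hl).2 fun i => ?_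
  have h1 := hx i (mem_univ i)
  have h2 := hy i (mem_univ i)
  rw [Pi.sub_apply, Real.norm_eq_abs, abs_le]
  exact ⟨by linarith [h1.1, h2.2], by linarith [h1.2, h2.1]⟩

/-- The subcubes of side length `l / N` into which a cube decomposes. -/
def subcube (c : ι → ℝ) (l : ℝ) (N : ℕ) (j : ι → Fin N) : Set (ι → ℝ) :=
  cube (fun i => c i + j i * (l / N)) (l / N)

theorem measurableSet_subcube (c : ι → ℝ) (l : ℝ) (N : ℕ) (j : ι → Fin N) :
    MeasurableSet (subcube c l N j) :=
  measurableSet_cube _ _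

theorem pairwise_disjoint_subcube (c : ι → ℝ) {l : ℝ} (hl : 0 < l) (N : ℕ) :
    Pairwise (Function.onFun Disjoint (subcube c l N)) := by
  intro j k hjk
  obtain ⟨i, hi⟩ := Function.ne_iff.1 hjk
  refine Set.disjoint_left.2 fun x hx hy => ?_
  have h1 := hx i (mem_univ i)
  have h2 := hy i (mem_univ i)
  have hN : (0 : ℝ) < N := by exact_mod_cast (j i).pos
  have hh : 0 < l / N := by positivity
  have key : ∀ a b : ℕ, a < b → c i + a * (l / N) + l / N ≤ c i + b * (l / N) := fun a b hab => by
    have : (a : ℝ) + 1 ≤ b := by exact_mod_cast hab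
    nlinarith
  rcases lt_or_gt_of_ne (Fin.val_ne_of_ne hi) with h | h
  · linarith [key _ _ h, h1.2, h2.1]
  · linarith [key _ _ h, h2.2, h1.1]

theorem iUnion_subcube (c : ι → ℝ) {l : ℝ} (hl : 0 < l) {N : ℕ} (hN : 0 < N) :
    ⋃ j, subcube c l N j = cube c l := by
  have hN' : (0 : ℝ) < N := by exact_mod_cast hN
  have hh : 0 < l / N := by positivity
  have hNl : N * (l / N) = l := by field_simp
  ext x
  rw [mem_iUnion]
  constructor
  · rintro ⟨j, hj⟩ i -
    have h1 := hj i (mem_univ i)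
    have h2 : ((j i : ℕ) : ℝ) + 1 ≤ N := by exact_mod_cast (j i).isLt
    have h3 : (0 : ℝ) ≤ (j i : ℕ) * (l / N) := by positivity
    exact ⟨by linarith [h1.1], by nlinarith [h1.2]⟩
  · intro hx
    have h1 : ∀ i, ∃ j : Fin N, c i + j * (l / N) < x i ∧ x i ≤ c i + j * (l / N) + l / N := by
      intro i
      obtain ⟨hx1, hx2⟩ := hx i (mem_univ i)
      set t := (x i - c i) / (l / N) with ht
      have htpos : 0 < t := div_pos (by linarith) hh
      have hx' : x i = c i + t * (l / N) := by rw [ht]; field_simp; ring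
      have htN : t ≤ N := by
        rw [ht, div_le_iff₀ hh, hNl]; linarith
      have hc : 0 < ⌈t⌉₊ := Nat.ceil_pos.2 htpos
      obtain ⟨k, hk⟩ : ∃ k, ⌈t⌉₊ = k + 1 := ⟨⌈t⌉₊ - 1, by omega⟩
      have hkN : k < N := by
        have : ⌈t⌉₊ ≤ N := Nat.ceil_le.2 htN
        omega
      have h2 : t ≤ k + 1 := by
        have := Nat.le_ceil t
        rw [hk] at this
        exact_mod_cast this
      have h3 : (k : ℝ) < t := Nat.lt_ceil.1 (by omega)
      refine ⟨⟨k, hkN⟩, ?_, ?_⟩ <;> simp only <;> rw [hx'] <;> nlinarith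
    choose j hj using h1
    exact ⟨j, fun i _ => hj i⟩

theorem lintegral_cube_eq_sum (c : ι → ℝ) {l : ℝ} (hl : 0 < l) {N : ℕ} (hN : 0 < N)
    (f : (ι → ℝ) → ℝ≥0∞) :
    ∫⁻ x in cube c l, f x = ∑ j, ∫⁻ x in subcube c l N j, f x := by
  rw [← iUnion_subcube c hl hN, lintegral_iUnion (fun _ => measurableSet_subcube _ _ _ _)
    (pairwise_disjoint_subcube c hl N), tsum_fintype]

theorem sum_volume_subcube (c : ι → ℝ) {l : ℝ} (hl : 0 < l) {N : ℕ} (hN : 0 < N) :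
    ∑ j, volume (subcube c l N j) = volume (cube c l) := by
  have := lintegral_cube_eq_sum c hl hN 1
  simpa using this.symm

/-- Approximation of `w` on a cube by a function constant on the subcubes. -/
theorem sum_lintegral_sub_average_le {w : (ι → ℝ) → ℝ} (hw : Measurable w) {c : ι → ℝ} {l : ℝ}
    (hl : 0 < l) (hwi : IntegrableOn w (cube c l)) {N : ℕ} (hN : 0 < N) {τ : ℝ} (hτ : 0 < τ) :
    ∑ j, ∫⁻ x in subcube c l N j, ‖w x - ⨍ y in subcube c l N j, w y‖ₑ
      ≤ ENNReal.ofReal τ * volume (cube c l) + 4 * ENNReal.ofReal τ * ENNReal.ofReal (l / N)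
        * ∫⁻ x in cube c l, ∫⁻ y in cube c l, jumpKernel (Fintype.card ι + 1) w τ x y := by
  set n := Fintype.card ι
  have hN' : (0 : ℝ) < N := by exact_mod_cast hN
  have hh : 0 < l / N := by positivity
  have hsub : ∀ j, subcube c l N j ⊆ cube c l := fun j => by
    rw [← iUnion_subcube c hl hN]; exact subset_iUnion _ j
  have hcell : ∀ j, ∫⁻ x in subcube c l N j, ‖w x - ⨍ y in subcube c l N j, w y‖ₑ
      ≤ ENNReal.ofReal τ * volume (subcube c l N j) + 4 * ENNReal.ofReal τ * ENNReal.ofReal (l / N)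
        * ∫⁻ x in subcube c l N j, ∫⁻ y in cube c l, jumpKernel (n + 1) w τ x y := by
    intro j
    set q := subcube c l N j
    have hv : volume q = ENNReal.ofReal (l / N) ^ n := volume_cube _ _
    have h0 : volume q ≠ 0 := by rw [hv]; exact pow_ne_zero _ (by simpa using hh)
    have htop : volume q ≠ ⊤ := by rw [hv]; finiteness
    have hP := lintegral_enorm_sub_le (μ := volume) (convex_cube _ _) (measurableSet_cube _ _) hw
      hτ hh (fun x (hx : x ∈ q) y hy => norm_sub_le_of_mem_cube hh.le hx hy)
    rw [Module.finrank_fintype_fun_eq_card] at hP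
    change ∫⁻ x in q, ∫⁻ y in q, ‖w x - w y‖ₑ ≤ ENNReal.ofReal τ * volume q * volume q
      + 4 * ENNReal.ofReal τ * ENNReal.ofReal (l / N) ^ (n + 1)
        * ∫⁻ x in q, ∫⁻ y in q, jumpKernel (n + 1) w τ x y at hP
    calc ∫⁻ x in q, ‖w x - ⨍ y in q, w y‖ₑ
        ≤ ∫⁻ x in q, (volume q)⁻¹ * ∫⁻ y in q, ‖w x - w y‖ₑ :=
          lintegral_mono fun x => enorm_sub_setAverage_le h0 htop (hwi.mono_set (hsub j)) x
      _ = (volume q)⁻¹ * ∫⁻ x in q, ∫⁻ y in q, ‖w x - w y‖ₑ :=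
          lintegral_const_mul' _ _ (ENNReal.inv_ne_top.2 h0)
      _ ≤ (volume q)⁻¹ * _ := mul_le_mul_right hP _
      -- The power `d + 1` of the side is the volume of `q` times one further side length. That
      -- spare factor `l / N` makes the kernel term small for large `N`.
      _ = ((volume q)⁻¹ * volume q) * (ENNReal.ofReal τ * volume q
          + 4 * ENNReal.ofReal τ * ENNReal.ofReal (l / N)
            * ∫⁻ x in q, ∫⁻ y in q, jumpKernel (n + 1) w τ x y) := by
          rw [pow_succ, ← hv]; ring
      _ ≤ _ := by
          -- The inner domain is enlarged to the whole cube, so that the outer integrals add up over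
          -- `j`.
          rw [ENNReal.inv_mul_cancel h0 htop, one_mul]
          gcongr with x
          exact hsub j
  refine (Finset.sum_le_sum fun j _ => hcell j).trans (le_of_eq ?_)
  rw [Finset.sum_add_distrib, ← Finset.mul_sum, ← Finset.mul_sum, sum_volume_subcube c hl hN,
    ← lintegral_cube_eq_sum c hl hN]

theorem isL1Precompact_cube {w : ℕ → (ι → ℝ) → ℝ} (hw : ∀ n, Measurable (w n)) {c : ι → ℝ} {l : ℝ}
    (hl : 0 < l) {C : ℝ≥0∞} (hC : C ≠ ⊤) (hwC : ∀ n, ∫⁻ x in cube c l, ‖w n x‖ₑ ≤ C)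
    (hJ : ∀ τ : ℝ, 0 < τ → ∃ D : ℝ≥0∞, D ≠ ⊤ ∧ ∀ n, ∫⁻ x in cube c l, ∫⁻ y in cube c l,
      jumpKernel (Fintype.card ι + 1) (w n) τ x y ≤ D) :
    IsL1Precompact (volume.restrict (cube c l)) w := by
  intro ε hε
  set v : ℝ := l ^ Fintype.card ι
  have hv : 0 < v := by positivity
  have hvol : volume (cube c l) = ENNReal.ofReal v := by
    rw [volume_cube, ENNReal.ofReal_pow hl.le]
  obtain ⟨e, he, heε⟩ : ∃ e : ℝ, 0 < e ∧ ENNReal.ofReal e ≤ ε := by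
    rcases eq_or_ne ε ⊤ with rfl | h
    · exact ⟨1, one_pos, le_top⟩
    · exact ⟨ε.toReal, ENNReal.toReal_pos hε h, ENNReal.ofReal_toReal h |>.le⟩
  -- The tolerance `e` is split into fifths: for each of `w m` and `w n`, one for the `τ` term and
  -- one for the kernel term; the last for the difference of the averages. `N` is chosen after `τ`,
  -- since `D` depends on `τ`.
  set τ : ℝ := e / (5 * v)
  have hτ : 0 < τ := by positivity
  obtain ⟨D, hD, hJD⟩ := hJ τ hτ
  obtain ⟨N, hN⟩ := exists_nat_gt (4 * τ * l * D.toReal / (e / 5))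
  have hNpos : (0 : ℝ) < N := lt_of_le_of_lt (by positivity) hN
  have hN0 : 0 < N := by exact_mod_cast hNpos
  have hint : ∀ n, IntegrableOn (w n) (cube c l) := fun n =>
    ⟨(hw n).aestronglyMeasurable, (hwC n).trans_lt hC.lt_top⟩
  set a : ℕ → (ι → Fin N) → ℝ := fun n j => ⨍ y in subcube c l N j, w n y
  have happrox : ∀ n, ∑ j, ∫⁻ x in subcube c l N j, ‖w n x - a n j‖ₑ
      ≤ ENNReal.ofReal (2 * e / 5) := by
    intro n
    refine (sum_lintegral_sub_average_le (hw n) hl (hint n) hN0 hτ).trans ?_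
    calc _ ≤ ENNReal.ofReal τ * ENNReal.ofReal v
          + 4 * ENNReal.ofReal τ * ENNReal.ofReal (l / N) * ENNReal.ofReal D.toReal := by
          rw [hvol, ENNReal.ofReal_toReal hD]
          gcongr
          exact hJD n
      _ = ENNReal.ofReal (τ * v + 4 * τ * (l / N) * D.toReal) := by
          rw [ENNReal.ofReal_add (by positivity) (by positivity),
            ENNReal.ofReal_mul (by positivity), ENNReal.ofReal_mul (by positivity),
            ENNReal.ofReal_mul (by positivity), ENNReal.ofReal_mul (by positivity)]
          simp
      _ ≤ _ := by
          refine ENNReal.ofReal_le_ofReal ?_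
          have h1 : τ * v = e / 5 := by simp only [τ]; field_simp
          have h2 : 4 * τ * (l / N) * D.toReal ≤ e / 5 := by
            rw [div_lt_iff₀ (by positivity)] at hN
            have : 4 * τ * (l / N) * D.toReal = 4 * τ * l * D.toReal / N := by ring
            rw [this, div_le_iff₀ hNpos]
            linarith
          linarith
  have hvq : ∀ j, volume (subcube c l N j) = ENNReal.ofReal (l / N) ^ Fintype.card ι :=
    fun j => volume_cube _ _
  have hh : 0 < l / N := by positivity
  set R : ℝ≥0∞ := (ENNReal.ofReal (l / N) ^ Fintype.card ι)⁻¹ * C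
  have hR : R ≠ ⊤ := ENNReal.mul_ne_top
    (ENNReal.inv_ne_top.2 (pow_ne_zero _ (by simpa using hh))) hC
  have ha : ∀ n j, |a n j| ≤ R.toReal := by
    intro n j
    have h1 := enorm_setAverage_le (μ := volume) (q := subcube c l N j)
      (by rw [hvq]; exact pow_ne_zero _ (by simpa using hh)) (by rw [hvq]; finiteness) (w n)
    have h2 : ‖a n j‖ₑ ≤ R := by
      refine h1.trans ?_
      rw [hvq]
      refine mul_le_mul_right ((lintegral_mono_set ?_).trans (hwC n)) _
      rw [← iUnion_subcube c hl hN0]; exact subset_iUnion _ j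
    rw [← Real.norm_eq_abs, ← toReal_enorm]
    exact ENNReal.toReal_mono hR h2
  obtain ⟨α, hα, col, hcol⟩ := exists_finite_coloring (η := e / (5 * v)) (by positivity) ha
  refine ⟨α, hα, col, fun m n hmn => le_trans ?_ heε⟩
  have hclose := hcol m n hmn
  rw [lintegral_cube_eq_sum c hl hN0]
  have hstep : ∀ j, ∫⁻ x in subcube c l N j, ‖w m x - w n x‖ₑ
      ≤ (∫⁻ x in subcube c l N j, ‖w m x - a m j‖ₑ)
        + (∫⁻ x in subcube c l N j, ‖w n x - a n j‖ₑ)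
        + ENNReal.ofReal (e / (5 * v)) * volume (subcube c l N j) := by
    intro j
    have hm1 : Measurable fun x => ‖w m x - a m j‖ₑ := by have := hw m; fun_prop
    rw [← setLIntegral_const, ← lintegral_add_left hm1, ← lintegral_add_right _ measurable_const]
    refine lintegral_mono fun x => ?_
    have h1 : w m x - w n x = (w m x - a m j) - (w n x - a n j) + (a m j - a n j) := by ring
    have h2 : ‖a m j - a n j‖ₑ ≤ ENNReal.ofReal (e / (5 * v)) := by
      rw [Real.enorm_eq_ofReal_abs]; exact ENNReal.ofReal_le_ofReal (hclose j)
    dsimp only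
    rw [h1]
    exact (enorm_add_le _ _).trans (add_le_add enorm_sub_le h2)
  refine (Finset.sum_le_sum fun j _ => hstep j).trans ?_
  rw [Finset.sum_add_distrib, Finset.sum_add_distrib, ← Finset.mul_sum,
    sum_volume_subcube c hl hN0, hvol]
  refine (add_le_add (add_le_add (happrox m) (happrox n)) le_rfl).trans (le_of_eq ?_)
  rw [← ENNReal.ofReal_mul (by positivity), ← ENNReal.ofReal_add (by positivity) (by positivity),
    ← ENNReal.ofReal_add (by positivity) (by positivity)]
  congr 1
  field_simp
  ring

end Cube

/-! ### Shears preserve volume -/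

section Shear

variable {V : Type*} [NormedAddCommGroup V] [NormedSpace ℝ V] [MeasurableSpace V] [BorelSpace V]
  [SecondCountableTopology V] {μ : Measure V} [μ.IsAddLeftInvariant] [SFinite μ]

/-- Fubini along the lines parallel to `e`, without coordinates: the integral is averaged over
translations by `t • e` with a probability density `ρ`. A shift of `t` by `h x` moves the shear into
the argument of `ρ`, where it integrates out. -/
theorem measurePreserving_shear {e : V} {h : V → ℝ} (hm : Measurable h)
    (hinv : ∀ x (t : ℝ), h (x + t • e) = h x) :
    MeasurePreserving (fun x => x + h x • e) μ μ := by
  have hS : Measurable fun x : V => x + h x • e := by fun_prop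
  refine ⟨hS, Measure.ext_of_lintegral _ fun f hf => ?_⟩
  rw [lintegral_map hf hS]
  let ρ : ℝ → ℝ≥0∞ := (Icc 0 1).indicator 1
  have hρ : Measurable ρ := measurable_one.indicator measurableSet_Icc
  have hρ1 : ∫⁻ t, ρ t = 1 := by
    simp only [ρ]
    rw [lintegral_indicator_one measurableSet_Icc]
    simp
  have htr : ∀ (F : V → ℝ≥0∞) (t : ℝ), ∫⁻ x, F (x + t • e) ∂μ = ∫⁻ x, F x ∂μ := fun F t =>
    by simp_rw [add_comm _ (t • e)]; exact lintegral_add_left_eq_self F _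
  have hfS : Measurable fun x => f (x + h x • e) := hf.comp hS
  calc ∫⁻ x, f (x + h x • e) ∂μ
      = ∫⁻ t, ρ t * ∫⁻ x, f (x + h x • e) ∂μ := by
        rw [lintegral_mul_const _ hρ, hρ1, one_mul]
    _ = ∫⁻ t : ℝ, ∫⁻ x, ρ t * f (x + (t + h x) • e) ∂μ := by
        refine lintegral_congr fun t => ?_
        rw [← htr (fun x => f (x + h x • e)) t, ← lintegral_const_mul]
        · simp_rw [hinv, add_smul, add_assoc]
        · exact hfS.comp (measurable_add_const _)
    _ = ∫⁻ x, ∫⁻ t : ℝ, ρ t * f (x + (t + h x) • e) ∂volume ∂μ := by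
        refine lintegral_lintegral_swap (Measurable.aemeasurable ?_)
        unfold Function.uncurry
        fun_prop
    _ = ∫⁻ x, ∫⁻ t : ℝ, ρ (t - h x) * f (x + t • e) ∂volume ∂μ := by
        refine lintegral_congr fun x => ?_
        rw [← lintegral_add_right_eq_self (fun t => ρ (t - h x) * f (x + t • e)) (h x)]
        simp
    _ = ∫⁻ t : ℝ, ∫⁻ x, ρ (t - h x) * f (x + t • e) ∂μ := by
        refine lintegral_lintegral_swap (Measurable.aemeasurable ?_)
        unfold Function.uncurry
        fun_prop
    _ = ∫⁻ t : ℝ, ∫⁻ x, ρ (t - h x) * f x ∂μ := by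
        refine lintegral_congr fun t => ?_
        rw [← htr (fun x => ρ (t - h x) * f x) t]
        simp_rw [hinv]
    _ = ∫⁻ x, ∫⁻ t : ℝ, ρ (t - h x) * f x ∂volume ∂μ := by
        refine lintegral_lintegral_swap (Measurable.aemeasurable ?_)
        unfold Function.uncurry
        fun_prop
    _ = ∫⁻ x, f x ∂μ := by
        refine lintegral_congr fun x => ?_
        rw [lintegral_mul_const _ (by fun_prop), lintegral_sub_right_eq_self, hρ1, one_mul]

/-- The shear `x ↦ x + h x • e` along `e`, for `h` invariant in the direction `e`. -/
def shear {e : V} {h : V → ℝ} (hc : Continuous h) (hinv : ∀ x (t : ℝ), h (x + t • e) = h x) :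
    V ≃ₜ V where
  toFun x := x + h x • e
  invFun x := x - h x • e
  left_inv x := by simp [hinv]
  right_inv x := by
    have : h (x - h x • e) = h x := by rw [sub_eq_add_neg, ← neg_smul, hinv]
    simp [this]
  continuous_toFun := by fun_prop
  continuous_invFun := by fun_prop

end Shear

/-! ### Transport through Lipschitz, measure preserving charts -/

section Patch

variable {d : ℕ} {E : Type*} [NormedAddCommGroup E] [MeasurableSpace E] [BorelSpace E]
  {ν : Measure E} {Ω : Set E} {u : ℕ → E → ℝ}

theorem IsL1Precompact.mono {X : Type*} [MeasurableSpace X] {μ ν : Measure X} {u : ℕ → X → ℝ}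
    (h : IsL1Precompact ν u) (hμ : μ ≤ ν) : IsL1Precompact μ u := fun ε hε => by
  obtain ⟨α, hα, c, hc⟩ := h ε hε
  exact ⟨α, hα, c, fun m n hmn => (lintegral_mono' hμ le_rfl).trans (hc m n hmn)⟩

theorem IsL1Precompact.add {X : Type*} [MeasurableSpace X] {μ ν : Measure X} {u : ℕ → X → ℝ}
    (hμ : IsL1Precompact μ u) (hν : IsL1Precompact ν u) : IsL1Precompact (μ + ν) u := fun ε hε => by
  have hε2 : ε / 2 ≠ 0 := (ENNReal.half_pos hε).ne'
  obtain ⟨α, hα, c, hc⟩ := hμ _ hε2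
  obtain ⟨β, hβ, c', hc'⟩ := hν _ hε2
  refine ⟨α × β, inferInstance, fun n => (c n, c' n), fun m n hmn => ?_⟩
  rw [lintegral_add_measure, ← ENNReal.add_halves ε]
  exact add_le_add (hc m n (congrArg Prod.fst hmn)) (hc' m n (congrArg Prod.snd hmn))

theorem jumpKernel_comp_le {V : Type*} [NormedAddCommGroup V] {Φ : V → E} {L : ℝ≥0∞} (hL0 : L ≠ 0)
    (hL : L ≠ ⊤) {x y : V} (h : ‖Φ x - Φ y‖ₑ ≤ L * ‖x - y‖ₑ) (n : ℕ) (f : E → ℝ) (τ : ℝ) :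
    jumpKernel n (f ∘ Φ) τ x y ≤ L ^ n * jumpKernel n f τ (Φ x) (Φ y) := by
  unfold jumpKernel
  simp only [Function.comp]
  split_ifs
  · have hLn : L ^ n ≠ 0 := pow_ne_zero _ hL0
    have hLn' : L ^ n ≠ ⊤ := ENNReal.pow_ne_top hL
    calc (‖x - y‖ₑ ^ n)⁻¹ = L ^ n * ((L * ‖x - y‖ₑ) ^ n)⁻¹ := by
          rw [mul_pow, ENNReal.mul_inv (Or.inl hLn) (Or.inl hLn'), ← mul_assoc,
            ENNReal.mul_inv_cancel hLn hLn', one_mul]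
      _ ≤ _ := by gcongr
  · exact zero_le

/-- Precompactness on the image of a cube under a measure preserving homeomorphism that is
Lipschitz on the cube. -/
theorem isL1Precompact_image_cube [SecondCountableTopology E] [SFinite ν]
    (hu : ∀ n, Measurable (u n)) {C : ℝ≥0∞} (hC : C ≠ ⊤)
    (huC : ∀ n, ∫⁻ x in Ω, ‖u n x‖ₑ ∂ν ≤ C)
    (hJ : ∀ τ : ℝ, 0 < τ → ∃ D : ℝ≥0∞, D ≠ ⊤ ∧ ∀ n, ∫⁻ x in Ω, ∫⁻ y in Ω,
      jumpKernel (d + 1) (u n) τ x y ∂ν ∂ν ≤ D)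
    (Φ : (Fin d → ℝ) ≃ₜ E) (hΦ : MeasurePreserving Φ volume ν) {c : Fin d → ℝ} {l : ℝ} (hl : 0 < l)
    {K : NNReal} (hK : LipschitzOnWith K Φ (cube c l)) (hsub : Φ '' cube c l ⊆ Ω) :
    IsL1Precompact (ν.restrict (Φ '' cube c l)) u := by
  have hemb : MeasurableEmbedding Φ := Φ.measurableEmbedding
  have hw : ∀ n, Measurable (u n ∘ Φ) := fun n => (hu n).comp Φ.continuous.measurable
  -- The added `1` makes the constant nonzero, so that its powers can be cancelled.
  set L : ℝ≥0∞ := (K : ℝ≥0∞) + 1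
  have hL0 : L ≠ 0 := by simp [L]
  have hL : L ≠ ⊤ := by simp [L]
  have key : IsL1Precompact (volume.restrict (cube c l)) (fun n => u n ∘ Φ) := by
    refine isL1Precompact_cube hw hl hC (fun n => ?_) fun τ hτ => ?_
    · have := hΦ.setLIntegral_comp_emb hemb (fun x => ‖u n x‖ₑ) (cube c l)
      exact this.le.trans ((lintegral_mono_set hsub).trans (huC n))
    · obtain ⟨D, hD, hJD⟩ := hJ τ hτ
      refine ⟨L ^ (d + 1) * D, ENNReal.mul_ne_top (ENNReal.pow_ne_top hL) hD, fun n => ?_⟩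
      rw [Fintype.card_fin]
      have hLn' : L ^ (d + 1) ≠ ⊤ := ENNReal.pow_ne_top hL
      calc ∫⁻ x in cube c l, ∫⁻ y in cube c l, jumpKernel (d + 1) (u n ∘ Φ) τ x y
          ≤ ∫⁻ x in cube c l, ∫⁻ y in cube c l,
              L ^ (d + 1) * jumpKernel (d + 1) (u n) τ (Φ x) (Φ y) := by
            refine setLIntegral_mono' (measurableSet_cube _ _) fun x hx =>
              setLIntegral_mono' (measurableSet_cube _ _) fun y hy => ?_
            refine jumpKernel_comp_le hL0 hL ?_ _ _ _
            have := hK hx hy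
            rw [edist_eq_enorm_sub, edist_eq_enorm_sub] at this
            exact this.trans (mul_le_mul_left le_self_add _)
        _ = L ^ (d + 1) * ∫⁻ x in Φ '' cube c l, ∫⁻ y in Φ '' cube c l,
              jumpKernel (d + 1) (u n) τ x y ∂ν ∂ν := by
            simp_rw [lintegral_const_mul' _ _ hLn']
            congr 1
            rw [← hΦ.setLIntegral_comp_emb hemb]
            refine lintegral_congr fun x => ?_
            exact hΦ.setLIntegral_comp_emb hemb (jumpKernel (d + 1) (u n) τ (Φ x)) _
        _ ≤ L ^ (d + 1) * D := by
            gcongr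
            refine le_trans ?_ (hJD n)
            exact (lintegral_mono_set hsub).trans
              (lintegral_mono fun x => lintegral_mono_set hsub)
  intro ε hε
  obtain ⟨α, hα, col, hcol⟩ := key ε hε
  refine ⟨α, hα, col, fun m n hmn => ?_⟩
  have := hΦ.setLIntegral_comp_emb hemb (fun x => ‖u m x - u n x‖ₑ) (cube c l)
  exact this.symm.le.trans (hcol m n hmn)

end Patch

/-! ### Local total boundedness at interior and boundary points -/

section Local

variable {d : ℕ}

/-- The point of `ℝ^d` with given coordinates in an orthonormal basis. -/
noncomputable def ofCoords (b : OrthonormalBasis (Fin d) ℝ (EuclideanSpace ℝ (Fin d))) :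
    (Fin d → ℝ) ≃L[ℝ] EuclideanSpace ℝ (Fin d) :=
  (EuclideanSpace.equiv (Fin d) ℝ).symm.trans b.repr.symm.toContinuousLinearEquiv

theorem inner_ofCoords (b : OrthonormalBasis (Fin d) ℝ (EuclideanSpace ℝ (Fin d))) (i : Fin d)
    (y : Fin d → ℝ) : inner ℝ (b i) (ofCoords b y) = y i := by
  rw [← b.repr_apply_apply]
  simp [ofCoords]

theorem measurePreserving_ofCoords
    (b : OrthonormalBasis (Fin d) ℝ (EuclideanSpace ℝ (Fin d))) :
    MeasurePreserving (ofCoords b) volume volume :=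
  b.measurePreserving_repr_symm.comp (PiLp.volume_preserving_toLp (Fin d))

theorem exists_orthonormalBasis_apply_eq {e : EuclideanSpace ℝ (Fin d)} (he : ‖e‖ = 1)
    (i : Fin d) : ∃ b : OrthonormalBasis (Fin d) ℝ (EuclideanSpace ℝ (Fin d)), b i = e := by
  have hv : Orthonormal ℝ (({i} : Set (Fin d)).domRestrict fun _ => e) :=
    ⟨fun _ => he, fun x y hxy => absurd (Subsingleton.elim x y) hxy⟩
  obtain ⟨b, hb⟩ := hv.exists_orthonormalBasis_extension_of_card_eq (by simp)
  exact ⟨b, hb i rfl⟩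

theorem exists_pos_lipschitzOnWith_closedBall {E : Type*} [NormedAddCommGroup E] [NormedSpace ℝ E]
    {Φ : (Fin d → ℝ) → E} (hΦ : ContDiff ℝ 1 Φ) (y₀ : Fin d → ℝ) {W : Set E}
    (hW : W ∈ 𝓝 (Φ y₀)) :
    ∃ ρ > 0, (∀ y ∈ Metric.closedBall y₀ ρ, Φ y ∈ W) ∧
      ∃ K : NNReal, LipschitzOnWith K Φ (Metric.closedBall y₀ ρ) := by
  obtain ⟨K, t, ht, hK⟩ := (hΦ.contDiffAt (x := y₀)).exists_lipschitzOnWith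
  have hWt : Φ ⁻¹' W ∩ t ∈ 𝓝 y₀ := inter_mem (hΦ.continuous.continuousAt hW) ht
  obtain ⟨ρ, hρ, hsub⟩ := Metric.nhds_basis_closedBall.mem_iff.1 hWt
  exact ⟨ρ, hρ, fun y hy => (hsub hy).1, K, hK.mono fun y hy => (hsub hy).2⟩

variable {Ω : Set (EuclideanSpace ℝ (Fin d))} {u : ℕ → EuclideanSpace ℝ (Fin d) → ℝ}

theorem exists_nhds_isL1Precompact_of_mem_interior
    (hu : ∀ n, Measurable (u n)) {C : ℝ≥0∞} (hC : C ≠ ⊤)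
    (huC : ∀ n, ∫⁻ x in Ω, ‖u n x‖ₑ ≤ C)
    (hJ : ∀ τ : ℝ, 0 < τ → ∃ D : ℝ≥0∞, D ≠ ⊤ ∧ ∀ n, ∫⁻ x in Ω, ∫⁻ y in Ω,
      jumpKernel (d + 1) (u n) τ x y ≤ D) {x₀ : EuclideanSpace ℝ (Fin d)} (hx₀ : Ω ∈ 𝓝 x₀) :
    ∃ U ∈ 𝓝 x₀, IsL1Precompact (volume.restrict (U ∩ Ω)) u := by
  let b := EuclideanSpace.basisFun (Fin d) ℝ
  let Φ := ofCoords b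
  obtain ⟨y₀, rfl⟩ := Φ.surjective x₀
  obtain ⟨ρ, hρ, hsub, K, hK⟩ :=
    exists_pos_lipschitzOnWith_closedBall Φ.contDiff y₀ hx₀
  set c : Fin d → ℝ := fun i => y₀ i - ρ
  have hcube : cube c (2 * ρ) ⊆ Metric.closedBall y₀ ρ := fun y hy => by
    refine (dist_pi_le_iff hρ.le).2 fun i => ?_
    have h := hy i (mem_univ i)
    simp only [c, mem_Ioc] at h
    rw [Real.dist_eq, abs_le]
    constructor <;> linarith
  refine ⟨Φ '' cube c (2 * ρ), ?_, ?_⟩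
  · refine Φ.toHomeomorph.isOpenMap.image_mem_nhds (mem_of_superset (Metric.ball_mem_nhds y₀ hρ) ?_)
    intro y hy i _
    have h := (dist_pi_lt_iff hρ).1 hy i
    rw [Real.dist_eq, abs_lt] at h
    constructor <;> simp only [c] <;> linarith
  · exact (isL1Precompact_image_cube hu hC huC hJ Φ.toHomeomorph (measurePreserving_ofCoords b)
      (by positivity) (hK.mono hcube) (image_subset_iff.2 fun y hy => hsub y (hcube hy))).mono
        (Measure.restrict_mono inter_subset_left le_rfl)

/-- In orthonormal coordinates with `e` as basis vector `i₀`, followed by the shear by the graph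
function, `Ω` becomes the half space `0 < y i₀` near `x₀`. A cube standing on its boundary
hyperplane is then mapped into `Ω`. -/
theorem exists_nhds_isL1Precompact_of_graph
    (hu : ∀ n, Measurable (u n)) {C : ℝ≥0∞} (hC : C ≠ ⊤)
    (huC : ∀ n, ∫⁻ x in Ω, ‖u n x‖ₑ ≤ C)
    (hJ : ∀ τ : ℝ, 0 < τ → ∃ D : ℝ≥0∞, D ≠ ⊤ ∧ ∀ n, ∫⁻ x in Ω, ∫⁻ y in Ω,
      jumpKernel (d + 1) (u n) τ x y ≤ D) {x₀ : EuclideanSpace ℝ (Fin d)}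
    (hx₀ : x₀ ∈ closure Ω) (hx₀' : x₀ ∉ Ω) {r : ℝ} (hr : 0 < r) {e : EuclideanSpace ℝ (Fin d)}
    (he : ‖e‖ = 1) {γ : EuclideanSpace ℝ (Fin d) → ℝ} (hγ : ContDiff ℝ 1 γ)
    (hΩ : ∀ x ∈ Metric.ball x₀ r, x ∈ Ω ↔ γ (x - inner ℝ e x • e) < inner ℝ e x) :
    ∃ U ∈ 𝓝 x₀, IsL1Precompact (volume.restrict (U ∩ Ω)) u := by
  have hee : inner ℝ e e = (1 : ℝ) := by rw [real_inner_self_eq_norm_sq, he]; norm_num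
  obtain ⟨i₀⟩ : Nonempty (Fin d) := by
    rcases Nat.eq_zero_or_pos d with rfl | h
    · rw [Subsingleton.elim e 0, norm_zero] at he
      exact absurd he zero_ne_one
    · exact ⟨⟨0, h⟩⟩
  obtain ⟨b, hb⟩ := exists_orthonormalBasis_apply_eq he i₀
  let h : EuclideanSpace ℝ (Fin d) → ℝ := fun x => γ (x - inner ℝ e x • e)
  have hγc := hγ.continuous
  have hh : Continuous h := by fun_prop
  have hinv : ∀ x (t : ℝ), h (x + t • e) = h x := fun x t => by
    simp only [h, inner_add_right, inner_smul_right, hee, mul_one, add_smul]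
    congr 1
    abel
  let Φ : (Fin d → ℝ) ≃ₜ EuclideanSpace ℝ (Fin d) :=
    (ofCoords b).toHomeomorph.trans (shear hh hinv)
  have hΦapp : ∀ y, Φ y = ofCoords b y + h (ofCoords b y) • e := fun y => rfl
  have hΦm : MeasurePreserving Φ volume volume :=
    (measurePreserving_shear hh.measurable hinv).comp (measurePreserving_ofCoords b)
  have hΦd : ContDiff ℝ 1 Φ := by
    have hL : ContDiff ℝ 1 (ofCoords b) := (ofCoords b).contDiff
    have : ContDiff ℝ 1 fun x : EuclideanSpace ℝ (Fin d) => x - inner ℝ e x • e :=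
      contDiff_id.sub ((contDiff_const.inner ℝ contDiff_id).smul contDiff_const)
    exact hL.add (((hγ.comp this).comp hL).smul contDiff_const)
  have hhΦ : ∀ y, h (Φ y) = h (ofCoords b y) := fun y => by rw [hΦapp, hinv]
  have hinner : ∀ y, inner ℝ e (Φ y) = y i₀ + h (Φ y) := fun y => by
    rw [hhΦ, hΦapp, inner_add_right, inner_smul_right, hee, mul_one]
    congr 1
    rw [← hb, inner_ofCoords]
  have hmem : ∀ y, Φ y ∈ Metric.ball x₀ r → (Φ y ∈ Ω ↔ 0 < y i₀) := fun y hy => by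
    rw [hΩ _ hy]
    change h (Φ y) < _ ↔ _
    rw [hinner]
    constructor <;> intro <;> linarith
  obtain ⟨y₀, hy₀⟩ := Φ.surjective x₀
  have hy₀i : y₀ i₀ = 0 := by
    refine le_antisymm ?_ ?_
    · rw [← not_lt, ← hmem y₀ (by rw [hy₀]; exact Metric.mem_ball_self hr), hy₀]
      exact hx₀'
    -- Otherwise a whole neighbourhood of `x₀` would lie below the graph and miss `Ω`.
    · by_contra! hneg
      have hN : Φ '' {y | y i₀ < 0} ∩ Metric.ball x₀ r ∈ 𝓝 x₀ := by
        refine inter_mem ?_ (Metric.ball_mem_nhds _ hr)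
        rw [← hy₀]
        exact Φ.isOpenMap.image_mem_nhds
          ((isOpen_lt (continuous_apply i₀) continuous_const).mem_nhds hneg)
      obtain ⟨_, ⟨⟨y, hy, rfl⟩, hyr⟩, hyΩ⟩ := mem_closure_iff_nhds.1 hx₀ _ hN
      exact lt_asymm ((hmem y hyr).1 hyΩ) hy
  obtain ⟨ρ, hρ, hsub, K, hK⟩ := exists_pos_lipschitzOnWith_closedBall hΦd y₀
    (W := Metric.ball x₀ r) (by rw [hy₀]; exact Metric.ball_mem_nhds _ hr)
  -- Cubes are open at their lower faces, so a lower corner at height `0` gives exactly `0 < y i₀`.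
  -- In the other directions the cube is centred at `y₀`; hence it contains the part of the ball of
  -- radius `ρ / 2` above the hyperplane.
  set c : Fin d → ℝ := fun i => if i = i₀ then 0 else y₀ i - ρ / 2
  have hcube : cube c ρ ⊆ Metric.closedBall y₀ ρ := fun y hy => by
    refine (dist_pi_le_iff hρ.le).2 fun i => ?_
    have h := hy i (mem_univ i)
    rw [Real.dist_eq, abs_le]
    by_cases hi : i = i₀
    · subst hi
      simp only [c, mem_Ioc, if_true] at h
      constructor <;> linarith
    · simp only [c, mem_Ioc, hi, if_false] at h
      constructor <;> linarith
  have hsubΩ : Φ '' cube c ρ ⊆ Ω := image_subset_iff.2 fun y hy => by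
    refine (hmem y (hsub y (hcube hy))).2 ?_
    have h := (hy i₀ (mem_univ i₀)).1
    simpa [c] using h
  refine ⟨Φ '' Metric.ball y₀ (ρ / 2), ?_, ?_⟩
  · rw [← hy₀]
    exact Φ.isOpenMap.image_mem_nhds (Metric.ball_mem_nhds y₀ (by positivity))
  · refine (isL1Precompact_image_cube hu hC huC hJ Φ hΦm hρ (hK.mono hcube) hsubΩ).mono
      (Measure.restrict_mono ?_ le_rfl)
    rintro _ ⟨⟨y, hy, rfl⟩, hyΩ⟩
    refine mem_image_of_mem _ fun i _ => ?_
    have h := (dist_pi_lt_iff (by positivity)).1 hy i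
    rw [Real.dist_eq, abs_lt] at h
    by_cases hi : i = i₀
    · subst hi
      have hpos := (hmem y (hsub y (Metric.closedBall_subset_closedBall (by linarith)
        (Metric.ball_subset_closedBall hy)))).1 hyΩ
      simp only [c, mem_Ioc, if_true]
      constructor <;> linarith
    · simp only [c, mem_Ioc, hi, if_false]
      constructor <;> linarith

end Local

/-! ### Gluing, extraction of a subsequence, and the bound by `Λ` -/

theorem IsCompact.isL1Precompact_inter {X : Type*} [TopologicalSpace X] [MeasurableSpace X]
    {μ : Measure X} {u : ℕ → X → ℝ} {K Ω : Set X} (hK : IsCompact K)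
    (h : ∀ x ∈ K, ∃ U ∈ 𝓝 x, IsL1Precompact (μ.restrict (U ∩ Ω)) u) :
    IsL1Precompact (μ.restrict (K ∩ Ω)) u := by
  refine hK.induction_on (p := fun s => IsL1Precompact (μ.restrict (s ∩ Ω)) u) ?_ ?_ ?_ ?_
  · intro ε _
    exact ⟨Unit, inferInstance, fun _ => (), fun _ _ _ => by simp⟩
  · exact fun s t hst ht => ht.mono (Measure.restrict_mono (inter_subset_inter_left _ hst) le_rfl)
  · intro s t hs ht
    rw [union_inter_distrib_right]
    exact (hs.add ht).mono (Measure.restrict_union_le _ _)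
  · intro x hx
    obtain ⟨U, hU, h⟩ := h x hx
    exact ⟨U, mem_nhdsWithin_of_mem_nhds hU, h⟩

theorem IsL1Precompact.exists_tendsto {X : Type} [MeasurableSpace X] {μ : Measure X}
    {u : ℕ → X → ℝ} (hu : ∀ n, MemLp (u n) 1 μ) (h : IsL1Precompact μ u) :
    ∃ (k : ℕ → ℕ) (v : X → ℝ), StrictMono k ∧ Measurable v ∧ MemLp v 1 μ ∧
      Tendsto (fun j => eLpNorm (u (k j) - v) 1 μ) atTop (𝓝 0) := by
  let f : ℕ → Lp ℝ 1 μ := fun n => (hu n).toLp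
  have htb : TotallyBounded (range f) := by
    refine Metric.totallyBounded_of_finite_discretization fun ε hε => ?_
    obtain ⟨α, hα, c, hc⟩ := h (ENNReal.ofReal (ε / 2)) (by simpa using hε)
    -- Several indices may give the same class in `L¹`; a class takes the colour of one chosen
    -- index.
    choose g hg using fun x : range f => x.2
    refine ⟨α, Fintype.ofFinite α, fun x => c (g x), fun x y hxy => ?_⟩
    have h1 := hc _ _ hxy
    rw [← hg x, ← hg y, Lp.dist_edist, Lp.edist_toLp_toLp, eLpNorm_one_eq_lintegral_enorm]
    refine (ENNReal.toReal_mono ENNReal.ofReal_ne_top h1).trans_lt ?_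
    rw [ENNReal.toReal_ofReal (by positivity)]
    linarith
  have hcpt : IsCompact (closure (range f)) :=
    isCompact_iff_totallyBounded_isComplete.2 ⟨htb.closure, isClosed_closure.isComplete⟩
  obtain ⟨v, -, k, hk, hlim⟩ := hcpt.tendsto_subseq fun n => subset_closure (mem_range_self n)
  have hlim' : Tendsto (fun j => eLpNorm (u (k j) - (v : X → ℝ)) 1 μ) atTop (𝓝 0) := by
    have h1 := (Lp.tendsto_Lp_iff_tendsto_eLpNorm' _ _).1 hlim
    refine h1.congr fun j => eLpNorm_congr_ae ?_
    exact (hu (k j)).coeFn_toLp.sub (ae_eq_refl _)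
  exact ⟨k, v, hk, (Lp.stronglyMeasurable v).measurable, Lp.memLp v, hlim'⟩

/-- On a jump, `φ |u x - u y|` is at least `φ τ` by monotonicity. -/
theorem lintegral_jumpKernel_le {d : ℕ} {φ : ℝ → ℝ} (hmono : MonotoneOn φ (Ici 0))
    {Ω : Set (EuclideanSpace ℝ (Fin d))} {u : EuclideanSpace ℝ (Fin d) → ℝ} {τ : ℝ} (hτ : 0 < τ)
    (hφ : 0 < φ τ) :
    ∫⁻ x in Ω, ∫⁻ y in Ω, jumpKernel (d + 1) u τ x y
      ≤ (ENNReal.ofReal (φ τ))⁻¹ * Lam φ Ω u := by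
  have hφ0 : ENNReal.ofReal (φ τ) ≠ 0 := by simpa using hφ
  have htop : (ENNReal.ofReal (φ τ))⁻¹ ≠ ⊤ := ENNReal.inv_ne_top.2 hφ0
  unfold Lam
  simp_rw [← lintegral_const_mul' _ _ htop]
  refine lintegral_mono fun x => lintegral_mono fun y => ?_
  unfold jumpKernel
  split_ifs with h
  · have hxy : 0 < ‖x - y‖ := by
      rw [norm_pos_iff, sub_ne_zero]
      rintro rfl
      simp at h
      linarith
    rw [ENNReal.ofReal_div_of_pos (by positivity), ENNReal.ofReal_pow hxy.le, ofReal_norm,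
      div_eq_mul_inv, ← mul_assoc]
    refine le_mul_of_one_le_left' ?_
    rw [← ENNReal.inv_mul_cancel hφ0 ENNReal.ofReal_ne_top]
    gcongr
    exact hmono (mem_Ici.2 hτ.le) (mem_Ici.2 (abs_nonneg _)) h.le
  · exact zero_le

theorem Lam_congr_ae {d : ℕ} {φ : ℝ → ℝ} {Ω : Set (EuclideanSpace ℝ (Fin d))}
    {u v : EuclideanSpace ℝ (Fin d) → ℝ} (h : u =ᵐ[volume.restrict Ω] v) :
    Lam φ Ω u = Lam φ Ω v := by
  unfold Lam
  refine lintegral_congr_ae ?_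
  filter_upwards [h] with x hx
  refine lintegral_congr_ae ?_
  filter_upwards [h] with y hy
  rw [hx, hy]

/-! ### A decaying weight, for the whole space -/

section Weight

variable {X : Type} [NormedAddCommGroup X] [MeasurableSpace X] [BorelSpace X] {μ : Measure X}

/-- The measure with density `(1 + ‖x‖)⁻¹` with respect to `μ`. -/
noncomputable def decayMeasure (μ : Measure X) : Measure X :=
  μ.withDensity fun x => (1 + ‖x‖ₑ)⁻¹

theorem lintegral_decayMeasure (f : X → ℝ≥0∞) (hf : Measurable f) :
    ∫⁻ x, f x ∂(decayMeasure μ) = ∫⁻ x, (1 + ‖x‖ₑ)⁻¹ * f x ∂μ :=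
  lintegral_withDensity_eq_lintegral_mul μ (by fun_prop) hf

theorem decayMeasure_le : decayMeasure μ ≤ μ := by
  calc decayMeasure μ ≤ μ.withDensity 1 := withDensity_mono (Eventually.of_forall fun x => by
        simp [ENNReal.inv_le_one])
    _ = μ := withDensity_one

theorem absolutelyContinuous_decayMeasure : μ ≪ decayMeasure μ :=
  withDensity_absolutelyContinuous' (by fun_prop) (Eventually.of_forall fun x => by
    simp)

/-- Outside a large ball the weight is small and the `L¹` norms are uniformly bounded, so only the
ball matters. One subsequence then serves all balls, with no diagonal extraction. -/
theorem IsL1Precompact.decayMeasure {u : ℕ → X → ℝ} (hu : ∀ n, Measurable (u n)) {C : ℝ≥0∞}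
    (hC : C ≠ ⊤) (huC : ∀ n, ∫⁻ x, ‖u n x‖ₑ ∂μ ≤ C)
    (h : ∀ R : ℝ, IsL1Precompact (μ.restrict (Metric.closedBall 0 R)) u) :
    IsL1Precompact (decayMeasure μ) u := by
  intro ε hε
  have hε2 : ε / 2 ≠ 0 := (ENNReal.half_pos hε).ne'
  obtain ⟨R, hR⟩ := ENNReal.exists_nat_gt (ENNReal.div_ne_top (ENNReal.mul_ne_top
    (ENNReal.ofNat_ne_top (n := 2)) hC) hε2)
  have hR' : (1 + (R : ℝ≥0∞))⁻¹ * (2 * C) ≤ ε / 2 := by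
    rw [mul_comm, ← div_eq_mul_inv]
    refine ENNReal.div_le_of_le_mul ?_
    rw [mul_comm (ε / 2)]
    exact (ENNReal.div_le_iff_le_mul (c := 1 + (R : ℝ≥0∞)) (Or.inl hε2) (Or.inr (by simp))).1
      (hR.le.trans le_add_self)
  obtain ⟨α, hα, c, hc⟩ := h R (ε / 2) hε2
  refine ⟨α, hα, c, fun m n hmn => ?_⟩
  have hm : Measurable fun x => ‖u m x - u n x‖ₑ := by
    have := hu m; have := hu n; fun_prop
  have hum : Measurable fun x => ‖u m x‖ₑ := (hu m).enorm
  have hS : MeasurableSet (Metric.closedBall (0 : X) R) := Metric.isClosed_closedBall.measurableSet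
  rw [lintegral_decayMeasure _ hm, ← lintegral_add_compl _ hS, ← ENNReal.add_halves ε]
  refine add_le_add (le_trans (lintegral_mono fun x => ?_) (hc m n hmn)) (le_trans ?_ hR')
  · exact mul_le_of_le_one_left' (by simp [ENNReal.inv_le_one])
  · calc ∫⁻ x in (Metric.closedBall (0 : X) R)ᶜ, (1 + ‖x‖ₑ)⁻¹ * ‖u m x - u n x‖ₑ ∂μ
        ≤ ∫⁻ x in (Metric.closedBall (0 : X) R)ᶜ, (1 + (R : ℝ≥0∞))⁻¹ * ‖u m x - u n x‖ₑ ∂μ := by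
          refine setLIntegral_mono' hS.compl fun x hx => ?_
          gcongr
          rw [mem_compl_iff, mem_closedBall_zero_iff, not_le] at hx
          rw [← ofReal_norm, ← ENNReal.ofReal_natCast]
          exact ENNReal.ofReal_le_ofReal hx.le
      _ ≤ ∫⁻ x, (1 + (R : ℝ≥0∞))⁻¹ * ‖u m x - u n x‖ₑ ∂μ := setLIntegral_le_lintegral _ _
      _ = (1 + (R : ℝ≥0∞))⁻¹ * ∫⁻ x, ‖u m x - u n x‖ₑ ∂μ := lintegral_const_mul _ hm
      _ ≤ (1 + (R : ℝ≥0∞))⁻¹ * (2 * C) := by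
          gcongr
          refine (lintegral_mono fun x => enorm_sub_le).trans ?_
          rw [lintegral_add_left hum, two_mul]
          exact add_le_add (huC m) (huC n)

theorem eLpNorm_restrict_closedBall_le_decayMeasure {f : X → ℝ} (hf : Measurable f) (R : ℝ) :
    eLpNorm f 1 (μ.restrict (Metric.closedBall 0 R))
      ≤ (1 + ENNReal.ofReal R) * eLpNorm f 1 (decayMeasure μ) := by
  have hS : MeasurableSet (Metric.closedBall (0 : X) R) := Metric.isClosed_closedBall.measurableSet
  have hfin : 1 + ENNReal.ofReal R ≠ ⊤ := by finiteness
  rw [eLpNorm_one_eq_lintegral_enorm, eLpNorm_one_eq_lintegral_enorm,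
    lintegral_decayMeasure _ hf.enorm, ← lintegral_const_mul' _ _ hfin]
  refine (setLIntegral_mono' hS fun x hx => ?_).trans (setLIntegral_le_lintegral _ _)
  rw [← mul_assoc]
  refine le_mul_of_one_le_left' ?_
  rw [← div_eq_mul_inv, ENNReal.le_div_iff_mul_le (by simp) (by simp), one_mul]
  gcongr
  rw [← ofReal_norm]
  exact ENNReal.ofReal_le_ofReal (mem_closedBall_zero_iff.1 hx)

end Weight

/-! ### The two cases of the theorem -/

section Main

variable {d : ℕ} {φ : ℝ → ℝ} {Ω : Set (EuclideanSpace ℝ (Fin d))}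
  {u : ℕ → EuclideanSpace ℝ (Fin d) → ℝ}

theorem exists_bound_jumpKernel (hmono : MonotoneOn φ (Ici 0)) (hpos : ∀ t : ℝ, 0 < t → 0 < φ t)
    (hL : (⨆ n, Lam φ Ω (u n)) < ⊤) :
    ∀ τ : ℝ, 0 < τ → ∃ D : ℝ≥0∞, D ≠ ⊤ ∧ ∀ n, ∫⁻ x in Ω, ∫⁻ y in Ω,
      jumpKernel (d + 1) (u n) τ x y ≤ D := fun τ hτ => by
  refine ⟨(ENNReal.ofReal (φ τ))⁻¹ * ⨆ n, Lam φ Ω (u n), ENNReal.mul_ne_top ?_ hL.ne, fun n => ?_⟩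
  · simpa using hpos τ hτ
  · exact (lintegral_jumpKernel_le hmono hτ (hpos τ hτ)).trans
      (mul_le_mul_right (le_iSup (fun n => Lam φ Ω (u n)) n) _)

theorem lintegral_enorm_le_iSup_eLpNorm {X : Type*} [MeasurableSpace X] (μ : Measure X)
    (u : ℕ → X → ℝ) (n : ℕ) : ∫⁻ x, ‖u n x‖ₑ ∂μ ≤ ⨆ n, eLpNorm (u n) 1 μ := by
  rw [← eLpNorm_one_eq_lintegral_enorm]
  exact le_iSup (fun n => eLpNorm (u n) 1 μ) n

theorem isL1Precompact_of_isSmoothBounded (hmono : MonotoneOn φ (Ici 0))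
    (hpos : ∀ t : ℝ, 0 < t → 0 < φ t) (hΩ : IsSmoothBounded Ω) (hu : ∀ n, Measurable (u n))
    (hC : (⨆ n, eLpNorm (u n) 1 (volume.restrict Ω)) < ⊤) (hL : (⨆ n, Lam φ Ω (u n)) < ⊤) :
    IsL1Precompact (volume.restrict Ω) u := by
  have hJ := exists_bound_jumpKernel hmono hpos hL
  have huC := lintegral_enorm_le_iSup_eLpNorm (volume.restrict Ω) u
  rw [← inter_eq_self_of_subset_right (subset_closure (s := Ω))]
  refine IsCompact.isL1Precompact_inter hΩ.isBounded.isCompact_closure fun x hx => ?_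
  by_cases hxΩ : x ∈ Ω
  · exact exists_nhds_isL1Precompact_of_mem_interior hu hC.ne huC hJ (hΩ.isOpen.mem_nhds hxΩ)
  · obtain ⟨r, e, γ, hr, he, hγ, hgraph⟩ := hΩ.boundary x
      ⟨hx, fun h => hxΩ (interior_subset h)⟩
    exact exists_nhds_isL1Precompact_of_graph hu hC.ne huC hJ hx hxΩ hr he
      (hγ.of_le (by exact_mod_cast le_top)) hgraph

theorem exists_tendsto_of_isSmoothBounded (hmono : MonotoneOn φ (Ici 0))
    (hpos : ∀ t : ℝ, 0 < t → 0 < φ t) (hΩ : IsSmoothBounded Ω)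
    (hu : ∀ n, MemLp (u n) 1 (volume.restrict Ω))
    (hC : (⨆ n, eLpNorm (u n) 1 (volume.restrict Ω)) < ⊤) (hL : (⨆ n, Lam φ Ω (u n)) < ⊤) :
    ∃ (k : ℕ → ℕ) (v : EuclideanSpace ℝ (Fin d) → ℝ), StrictMono k ∧
      MemLp v 1 (volume.restrict Ω) ∧
      Tendsto (fun j => eLpNorm (u (k j) - v) 1 (volume.restrict Ω)) atTop (𝓝 0) := by
  -- Measurable representatives may be used, as `Λ` depends only on the class of `u` almost
  -- everywhere on `Ω`.
  have hae : ∀ n, u n =ᵐ[volume.restrict Ω] (hu n).1.mk := fun n => (hu n).1.ae_eq_mk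
  have hpre := isL1Precompact_of_isSmoothBounded (u := fun n => (hu n).1.mk) hmono hpos hΩ
    (fun n => (hu n).1.stronglyMeasurable_mk.measurable)
    (by simpa only [← eLpNorm_congr_ae (hae _)] using hC)
    (by simpa only [← Lam_congr_ae (hae _)] using hL)
  obtain ⟨k, v, hk, -, hv, hlim⟩ := hpre.exists_tendsto fun n => (memLp_congr_ae (hae n)).1 (hu n)
  exact ⟨k, v, hk, hv, hlim.congr fun j =>
    eLpNorm_congr_ae ((hae (k j)).symm.sub (ae_eq_refl v))⟩

theorem exists_tendsto_univ (hmono : MonotoneOn φ (Ici 0)) (hpos : ∀ t : ℝ, 0 < t → 0 < φ t)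
    (hu : ∀ n, MemLp (u n) 1 volume) (hC : (⨆ n, eLpNorm (u n) 1 volume) < ⊤)
    (hL : (⨆ n, Lam φ univ (u n)) < ⊤) :
    ∃ (k : ℕ → ℕ) (v : EuclideanSpace ℝ (Fin d) → ℝ), StrictMono k ∧ MemLp v 1 volume ∧
      ∀ K : Set (EuclideanSpace ℝ (Fin d)), IsCompact K →
        Tendsto (fun j => eLpNorm (u (k j) - v) 1 (volume.restrict K)) atTop (𝓝 0) := by
  have hae : ∀ n, u n =ᵐ[volume] (hu n).1.mk := fun n => (hu n).1.ae_eq_mk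
  set w : ℕ → EuclideanSpace ℝ (Fin d) → ℝ := fun n => (hu n).1.mk
  have hwm : ∀ n, Measurable (w n) := fun n => (hu n).1.stronglyMeasurable_mk.measurable
  have hw : ∀ n, MemLp (w n) 1 volume := fun n => (memLp_congr_ae (hae n)).1 (hu n)
  have hwC : (⨆ n, eLpNorm (w n) 1 volume) < ⊤ := by
    simpa only [w, ← eLpNorm_congr_ae (hae _)] using hC
  have hwL : (⨆ n, Lam φ univ (w n)) < ⊤ := by
    have : ∀ n, Lam φ univ (w n) = Lam φ univ (u n) := fun n =>
      Lam_congr_ae (by rw [Measure.restrict_univ]; exact (hae n).symm)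
    simpa only [this] using hL
  have hJ := exists_bound_jumpKernel hmono hpos hwL
  have huC := lintegral_enorm_le_iSup_eLpNorm volume w
  have hball : ∀ R : ℝ, IsL1Precompact (volume.restrict (Metric.closedBall 0 R)) w := fun R => by
    rw [← inter_univ (Metric.closedBall _ _)]
    exact IsCompact.isL1Precompact_inter (isCompact_closedBall 0 R) fun x _ =>
      exists_nhds_isL1Precompact_of_mem_interior hwm hwC.ne (by simpa using huC) hJ univ_mem
  obtain ⟨k, v, hk, hvm, -, hlim⟩ :=
    (IsL1Precompact.decayMeasure hwm hwC.ne huC hball).exists_tendsto fun n =>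
      (hw n).mono_measure decayMeasure_le
  refine ⟨k, v, hk, ⟨hvm.aestronglyMeasurable, ?_⟩, fun K hK => ?_⟩
  -- Weighted convergence only puts `v` in the weighted space. A further subsequence converges
  -- almost everywhere, for Lebesgue measure too as the weight is positive, and Fatou's lemma gives
  -- integrability.
  · obtain ⟨ns, -, hns⟩ := (tendstoInMeasure_of_tendsto_eLpNorm one_ne_zero
      (fun j => (hwm (k j)).aestronglyMeasurable) hvm.aestronglyMeasurable hlim).exists_seq_tendsto_ae
    refine (Lp.eLpNorm_lim_le_liminf_eLpNorm (fun j => (hwm (k (ns j))).aestronglyMeasurable) v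
      (absolutelyContinuous_decayMeasure.ae_le hns)).trans_lt (lt_of_le_of_lt ?_ hwC)
    exact (liminf_le_liminf (Eventually.of_forall fun j =>
      le_iSup (fun n => eLpNorm (w n) 1 volume) (k (ns j)))).trans (by simp)
  · obtain ⟨R, hR⟩ := hK.isBounded.subset_closedBall 0
    have hlim' := ENNReal.Tendsto.const_mul (a := 1 + ENNReal.ofReal R) hlim
      (Or.inr (by finiteness))
    rw [mul_zero] at hlim'
    refine tendsto_of_tendsto_of_tendsto_of_le_of_le tendsto_const_nhds hlim'
      (fun _ => zero_le) fun j => ?_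
    calc eLpNorm (u (k j) - v) 1 (volume.restrict K)
        ≤ eLpNorm (u (k j) - v) 1 (volume.restrict (Metric.closedBall 0 R)) :=
          eLpNorm_mono_measure _ (Measure.restrict_mono hR le_rfl)
      _ = eLpNorm (w (k j) - v) 1 (volume.restrict (Metric.closedBall 0 R)) :=
          eLpNorm_congr_ae (Filter.EventuallyEq.sub
            (ae_restrict_of_ae (hae (k j))) (ae_eq_refl v))
      _ ≤ _ := eLpNorm_restrict_closedBall_le_decayMeasure ((hwm (k j)).sub hvm) R

end Main

end NonlocalTV

theorem theorem2 (d : ℕ) (hd : 1 ≤ d) (φ : ℝ → ℝ) (hφ : NonlocalTV.ClassA d φ)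
    (hpos : ∀ t : ℝ, 0 < t → 0 < φ t) :
    (∀ Ω : Set (EuclideanSpace ℝ (Fin d)), NonlocalTV.IsSmoothBounded Ω →
      ∀ u : ℕ → EuclideanSpace ℝ (Fin d) → ℝ,
        (∀ n, MemLp (u n) 1 (volume.restrict Ω)) →
        (⨆ n, eLpNorm (u n) 1 (volume.restrict Ω)) < ⊤ →
        (⨆ n, NonlocalTV.Lam φ Ω (u n)) < ⊤ →
        ∃ (k : ℕ → ℕ) (v : EuclideanSpace ℝ (Fin d) → ℝ), StrictMono k ∧
          MemLp v 1 (volume.restrict Ω) ∧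
          Tendsto (fun j => eLpNorm (u (k j) - v) 1 (volume.restrict Ω)) atTop (𝓝 0)) ∧
    (∀ u : ℕ → EuclideanSpace ℝ (Fin d) → ℝ,
        (∀ n, MemLp (u n) 1 volume) →
        (⨆ n, eLpNorm (u n) 1 volume) < ⊤ →
        (⨆ n, NonlocalTV.Lam φ univ (u n)) < ⊤ →
        ∃ (k : ℕ → ℕ) (v : EuclideanSpace ℝ (Fin d) → ℝ), StrictMono k ∧
          MemLp v 1 volume ∧
          ∀ K : Set (EuclideanSpace ℝ (Fin d)), IsCompact K →
            Tendsto (fun j => eLpNorm (u (k j) - v) 1 (volume.restrict K)) atTop (𝓝 0)) := by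
  exact ⟨fun _ hΩ _ hu hC hL =>
      NonlocalTV.exists_tendsto_of_isSmoothBounded hφ.monotone hpos hΩ hu hC hL,
    fun _ hu hC hL => NonlocalTV.exists_tendsto_univ hφ.monotone hpos hu hC hL⟩
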